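/- Let $\mathbb K$ be an algebraic number field of degree $\kappa=[\mathbb K:\mathbb Q]$ with ring of integers $\mathbb Z_{\mathbb K}$, and let $V_\infty$ be the set of Archimedean places of $\mathbb K$. For a place $v$ of $\mathbb K$ lying over $p$ (a prime number or $\infty$) let $|\cdot|_v$ be the absolute value on the completion $\mathbb K_v$ that extends the standard absolute value $|\cdot|_p$ of $\mathbb Q$ (with $|p|_p=1/p$ for a prime $p$), let $\kappa_v=[\mathbb K_v:\mathbb Q_p]$ (where $\mathbb Q_\infty=\mathbb R$), and put $\|x\|_v=|x|_v^{\kappa_v/\kappa}$. For a non-Archimedean place $v$ and $\alpha\in\mathbb Z_{\mathbb K}$ let $F_v(\alpha)=\sum_{n=0}^\infty n!\,\alpha^n\in\mathbb K_v$, a series which converges in $\mathbb K_v$. Let $m\ge 1$ be an integer, let $\alpha_1,\dots,\alpha_m\in\mathbb Z_{\mathbb K}\setminus\{0\}$ be pairwise distinct, and put $$c_1=\prod_{v\in V_\infty}\left(\Bigl(\max_{1\le j\le m}\{1,\|\alpha_j\|_v\}\Bigr)^m\prod_{i=1}^m\Bigl(\|\alpha_i\|_v+\max_{1\le j\le m}\{1,\|\alpha_j\|_v\}\Bigr)\right).$$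 Theorem. Let $\log H\ge s e^s$, where $s=\max\{e^\kappa+1,\;c_1+1,\;(m+3)^2+1\}$. Suppose that $\lambda_0,\lambda_1,\dots,\lambda_m\in\mathbb Z_{\mathbb K}$ are not all zero and that $$\prod_{v\in V_\infty}\max_{0\le i\le m}\|\lambda_i\|_v\le H.$$ Then there exist a prime number $$p\in\left]\log\left(\frac{\log H}{\log\log H}\right),\ \frac{17m\log H}{\log\log H}\right[$$ and a non-Archimedean place $v'$ of $\mathbb K$ with $v'\mid p$ such that $$\bigl\|\lambda_0+\lambda_1F_{v'}(\alpha_1)+\dots+\lambda_mF_{v'}(\alpha_m)\bigr\|_{v'}>H^{-(m+1)-114m^2\cdot\frac{\log\log\log H}{\log\log H}}.$$ -/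

import Mathlib

open NumberField IsDedekindDomain

namespace EulerSeries

variable {K : Type*} [Field K] [NumberField K]

/-- The normalised Archimedean absolute value `‖x‖_w = |x|_w ^ (κ_w / κ)`, where `κ = [K : ℚ]` and
`κ_w` (`w.mult`) is the local degree: `1` if `w` is real and `2` if `w` is complex. -/
noncomputable def infNorm (w : InfinitePlace K) (x : K) : ℝ :=
  w x ^ ((w.mult : ℝ) / (Module.finrank ℚ K : ℝ))

/-- The normalised absolute value `‖x‖_v = |x|_v ^ (κ_v / κ)` on the completion `K_v` at a maximal
ideal `v` of the ring of integers, where `|·|_v` extends the `p`-adic absolute value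
(`|p|_v = 1 / p`) and `κ_v = [K_v : ℚ_p] = e f`. Mathlib's norm on `K_v` takes the value
`(absNorm v)⁻¹` at a uniformiser, that is, it equals `|·|_v ^ κ_v`;
see `finNorm_natCast` for the resulting value at `p`. -/
noncomputable def finNorm (v : HeightOneSpectrum (𝓞 K)) (x : v.adicCompletion K) : ℝ :=
  ‖x‖ ^ (1 / (Module.finrank ℚ K : ℝ))

/-- The value `F_v(a) = ∑ n! a ^ n` of Euler's factorial series in the completion `K_v`;
the series converges, see `summable_eulerSeries`. -/
noncomputable def eulerF (v : HeightOneSpectrum (𝓞 K)) (a : 𝓞 K) : v.adicCompletion K :=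
  ∑' n : ℕ, (n.factorial : v.adicCompletion K) * FinitePlace.embedding v (a : K) ^ n

/-- The constant `c₁` attached to `(α_1, …, α_m)`. -/
noncomputable def c₁ {m : ℕ} (α : Fin m → 𝓞 K) : ℝ :=
  ∏ w : InfinitePlace K,
    ((max 1 (⨆ j, infNorm w (α j : K))) ^ m *
      ∏ i, (infNorm w (α i : K) + max 1 (⨆ j, infNorm w (α j : K))))

/-- The linear form `Λ_v = λ_0 + λ_1 F_v(α_1) + ⋯ + λ_m F_v(α_m)` in `K_v`. -/
noncomputable def linForm {m : ℕ} (v : HeightOneSpectrum (𝓞 K)) (α : Fin m → 𝓞 K)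
    (l : Fin (m + 1) → 𝓞 K) : v.adicCompletion K :=
  FinitePlace.embedding v (l 0 : K) +
    ∑ j : Fin m, FinitePlace.embedding v (l j.succ : K) * eulerF v (α j)

/-- The height `∏_{v ∣ ∞} max_i ‖λ_i‖_v`. -/
noncomputable def archHeight {m : ℕ} (l : Fin (m + 1) → 𝓞 K) : ℝ :=
  ∏ w : InfinitePlace K, ⨆ i, infNorm w (l i : K)

open Ideal in
/-- If `v` lies above the prime `p`, then `‖p‖_v = (1 / p) ^ (e f / κ)`. -/
theorem finNorm_natCast (v : HeightOneSpectrum (𝓞 K)) (p : ℕ) (hp : p.Prime)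
    (hv : (p : 𝓞 K) ∈ v.asIdeal) :
    finNorm v (p : v.adicCompletion K) = (1 / (p : ℝ)) ^
      (((ramificationIdx' (span {(p : ℤ)}) v.asIdeal *
        inertiaDeg' (span {(p : ℤ)}) v.asIdeal : ℕ) : ℝ) / (Module.finrank ℚ K : ℝ)) := by
  have hp0 : (p : 𝓞 K) ≠ 0 := Nat.cast_ne_zero.2 hp.ne_zero
  have hmap : map (algebraMap ℤ (𝓞 K)) (span {(p : ℤ)}) = span {(p : 𝓞 K)} := by
    simp [map_span]
  have hspan0 : span {(p : 𝓞 K)} ≠ ⊥ := by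
    rwa [Ne, span_singleton_eq_bot]
  have hmap0 : map (algebraMap ℤ (𝓞 K)) (span {(p : ℤ)}) ≠ ⊥ := by rwa [hmap]
  have hover : v.asIdeal.LiesOver (span {(p : ℤ)}) := by
    have hmax : (span {(p : ℤ)}).IsMaximal :=
      ((span_singleton_prime (by exact_mod_cast hp.ne_zero)).2
        (Nat.prime_iff_prime_int.1 hp)).isMaximal (by simpa using hp.ne_zero)
    refine ⟨hmax.eq_of_le (comap_ne_top _ v.isPrime.ne_top) ?_⟩
    rw [span_singleton_le_iff_mem, mem_comap]
    simpa using hv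
  have hN := absNorm_eq_pow_inertiaDeg' v.asIdeal hp
  have hval : ‖(p : v.adicCompletion K)‖ = ((p : ℝ)⁻¹) ^
      (ramificationIdx' (span {(p : ℤ)}) v.asIdeal *
        inertiaDeg' (span {(p : ℤ)}) v.asIdeal) := by
    have h := NumberField.HeightOneSpectrum.embedding_mul_absNorm K v hp0
    have hcast : FinitePlace.embedding v (algebraMap (𝓞 K) K (p : 𝓞 K)) =
        (p : v.adicCompletion K) := by simp
    rw [hcast, HeightOneSpectrum.maxPowDividing, map_pow, hN] at h
    have hcount : (Associates.mk v.asIdeal).count (Associates.mk (span {(p : 𝓞 K)})).factors =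
        ramificationIdx' (span {(p : ℤ)}) v.asIdeal := by
      rw [IsDedekindDomain.ramificationIdx'_eq_normalizedFactors_count hmap0 v.isPrime v.ne_bot,
        hmap, Ideal.count_associates_factors_eq hspan0 v.isPrime v.ne_bot]
    rw [hcount] at h
    push_cast at h
    rw [← pow_mul, mul_comm (inertiaDeg' _ _)] at h
    rw [inv_pow]
    exact eq_inv_of_mul_eq_one_left h
  rw [finNorm, hval, ← Real.rpow_natCast, ← Real.rpow_mul (by positivity), mul_one_div,
    one_div (p : ℝ)]

/-- Euler's factorial series converges in `K_v` at every algebraic integer of `K`. -/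
theorem summable_eulerSeries (v : HeightOneSpectrum (𝓞 K)) (a : 𝓞 K) :
    Summable fun n : ℕ =>
      (n.factorial : v.adicCompletion K) * FinitePlace.embedding v (a : K) ^ n := by
  have hN : ∃ q : ℕ, 0 < q ∧ ‖(q : v.adicCompletion K)‖ < 1 := by
    refine ⟨Ideal.absNorm v.asIdeal, Nat.pos_of_ne_zero ?_, ?_⟩
    · have := NumberField.HeightOneSpectrum.one_lt_absNorm v
      omega
    · have := (FinitePlace.norm_lt_one_iff_mem K v (Ideal.absNorm v.asIdeal : 𝓞 K)).2
        (Ideal.absNorm_mem v.asIdeal)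
      simpa using this
  obtain ⟨q, hq0, hq⟩ := hN
  have hle (n : ℕ) : ‖(n : v.adicCompletion K)‖ ≤ 1 := by
    simpa using FinitePlace.norm_le_one K v (n : 𝓞 K)
  have hdvd (n : ℕ) : q ^ (n / q) ∣ n.factorial := by
    have h1 : ∀ k : ℕ, q ^ k ∣ (q * k).factorial := by
      intro k
      induction k with
      | zero => simp
      | succ k ih =>
        have h2 := Nat.factorial_mul_factorial_dvd_factorial_add (q * k) q
        rw [pow_succ, Nat.mul_succ]
        exact (mul_dvd_mul ih (Nat.dvd_factorial hq0 le_rfl)).trans h2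
    exact (h1 _).trans (Nat.factorial_dvd_factorial (Nat.mul_div_le n q))
  have hbound (n : ℕ) :
      ‖(n.factorial : v.adicCompletion K) * FinitePlace.embedding v (a : K) ^ n‖ ≤
        ‖(q : v.adicCompletion K)‖ ^ (n / q) := by
    obtain ⟨c, hc⟩ := hdvd n
    rw [norm_mul, norm_pow, hc, Nat.cast_mul, Nat.cast_pow, norm_mul, norm_pow]
    have h1 := FinitePlace.norm_le_one K v a
    have h2 := pow_le_one₀ (n := n) (norm_nonneg _) h1
    have h3 := hle c
    have h4 : 0 ≤ ‖(q : v.adicCompletion K)‖ ^ (n / q) := by positivity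
    calc _ ≤ ‖(q : v.adicCompletion K)‖ ^ (n / q) * 1 * 1 := by gcongr
      _ = _ := by ring
  have : IsUltrametricDist (v.adicCompletion K) := by
    let _ := HeightOneSpectrum.instRankOneAdicCompletion K v
    exact Valued.instIsUltrametricDist _ _
  refine NonarchimedeanAddGroup.summable_of_tendsto_cofinite_zero ?_
  rw [Nat.cofinite_eq_atTop]
  refine squeeze_zero_norm hbound ?_
  exact (tendsto_pow_atTop_nhds_zero_of_lt_one (norm_nonneg _) hq).comp
    (Nat.tendsto_div_const_atTop hq0.ne')

end EulerSeries

namespace EulerSeries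

/-! The proof uses Padé-type approximation written as a linear functional. Let `Φ` send `X ^ k` to
`w k / k!`, where `w k` is the linear form with each `F(α_j)` replaced by its partial sum over `h <
k`. Put `g = ∏ (X - α_j)` and `W = M! Φ(g ^ l X ^ μ)` with `M = m l + μ`, `μ ≤ m`; this is
`approxForm`, an element of `K`, and it is estimated at every place.

At a finite place `v`, completing the partial sums to full series splits `W` into an integral
multiple of the linear form `Λ_v` and a combination of remainders. In each remainder the terms of
index `n < l` vanish because `(X - α_j) ^ l` divides `g ^ l X ^ μ`, so a factor `M! l!` appears, and
`|W|_v ≤ max |Λ_v| |M! l!|_v` (`norm_form_le_max`). At the Archimedean places the product of the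
normalised values of `W` is at most `M! (m + 1) H c₁ ^ l` (`prod_infNorm_approxForm_le`).

For some `μ ≤ m` the form `W` is nonzero (`exists_factorialFunctional_ne_zero`). The differential
equation of Euler's series makes `Φ` vanish on `X² f' + (X - 1) f` for `g ∣ f`, so if every `W`
vanished, `Φ` and hence all coefficients would be zero.

If `Λ_v` were small above every prime `p > u` dividing `M! l!`, then `W` would be divisible by the
part of `M! l!` made of primes exceeding `u`, and the product formula would bound that part by the
Archimedean estimate. The complementary part is at most `exp (0.92 (M + l) √u)`. Cancelling `M!`
leaves an upper bound for `l!`, which fails for `l ≈ 16 log H / log log H` and `u ≈ log (log H / log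
log H)` (`exists_order`). -/

open Polynomial in
/-- The linear functional on polynomials sending `X ^ k` to `w k / k!`. -/
noncomputable def factorialFunctional {L : Type*} [Field L] (w : ℕ → L) : L[X] →ₗ[L] L :=
  Polynomial.lsum fun k => (w k / (k.factorial : L)) • LinearMap.id

/-! ### Nonvanishing of the approximation forms. -/

section Functional

open Polynomial

variable {L : Type*} [Field L]

theorem factorialFunctional_apply (w : ℕ → L) (f : L[X]) :
    factorialFunctional w f = f.sum fun k a => w k / (k.factorial : L) * a := by
  simp [factorialFunctional, Polynomial.lsum_apply]

theorem factorialFunctional_eq_sum_range (w : ℕ → L) (f : L[X]) {n : ℕ} (hn : f.natDegree < n) :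
    factorialFunctional w f = ∑ k ∈ Finset.range n, w k / (k.factorial : L) * f.coeff k := by
  rw [factorialFunctional_apply, Polynomial.sum_over_range' _ _ _ hn]
  simp

theorem factorialFunctional_X_pow (w : ℕ → L) (k : ℕ) :
    factorialFunctional w (X ^ k) = w k / (k.factorial : L) := by
  rw [factorialFunctional_apply, ← monomial_one_right_eq_X_pow, sum_monomial_index _ _ (by simp)]
  simp

/-- The functional of the partial sums of Euler's series satisfies the functional equation
which reflects the differential equation of Euler's series. -/
theorem factorialFunctional_euler_operator [CharZero L] {ι : Type*} [Fintype ι] (c : L)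
    (b a : ι → L) (f : L[X]) :
    factorialFunctional (fun k => c + ∑ j, b j * ∑ h ∈ Finset.range k, (h.factorial : L) * a j ^ h)
      (X ^ 2 * derivative f + (X - 1) * f) = ∑ j, b j * f.eval (a j) := by
  induction f using Polynomial.induction_on' with
  | add p q hp hq =>
    simp only [eval_add, mul_add, Finset.sum_add_distrib]
    rw [← hp, ← hq, ← map_add]
    congr 1
    simp only [derivative_add]
    ring
  | monomial n r =>
    have h1 : X ^ 2 * derivative (monomial n r) + (X - 1) * monomial n r =
        (r * (n + 1)) • X ^ (n + 1) - r • (X ^ n : L[X]) := by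
      rw [← C_mul_X_pow_eq_monomial, smul_eq_C_mul, smul_eq_C_mul]
      rcases n with _ | n
      · simp
        ring
      · simp
        ring
    have hf : (n.factorial : L) ≠ 0 := by exact_mod_cast n.factorial_ne_zero
    have hn : (n : L) + 1 ≠ 0 := by exact_mod_cast n.succ_ne_zero
    rw [h1, map_sub, map_smul, map_smul, factorialFunctional_X_pow, factorialFunctional_X_pow]
    simp only [Finset.sum_range_succ, mul_add, Finset.sum_add_distrib, Nat.factorial_succ,
      Nat.cast_mul, Nat.cast_succ, eval_monomial, smul_eq_mul]
    have h2 : ∑ j, b j * (r * a j ^ n) = r * ∑ j, b j * a j ^ n := by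
      rw [Finset.mul_sum]
      exact Finset.sum_congr rfl fun _ _ => by ring
    have h3 : ∑ j, b j * ((n.factorial : L) * a j ^ n) = n.factorial * ∑ j, b j * a j ^ n := by
      rw [Finset.mul_sum]
      exact Finset.sum_congr rfl fun _ _ => by ring
    rw [h2, h3]
    field_simp
    ring

/-- A functional killing `X ^ 2 f' + (X - 1) f` for all multiples `f` of `g` vanishes on the ideal
of `g ^ l` as soon as it vanishes on `g ^ l X ^ μ` for `μ ≤ deg g`. -/
theorem map_pow_mul_eq_zero [CharZero L] {Φ : L[X] →ₗ[L] L} {g : L[X]} (hg : g.Monic)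
    (hE : ∀ f, g ∣ f → Φ (X ^ 2 * derivative f + (X - 1) * f) = 0) {l : ℕ}
    (h0 : ∀ μ ≤ g.natDegree, Φ (g ^ l * X ^ μ) = 0) (f : L[X]) : Φ (g ^ l * f) = 0 := by
  have key : ∀ n, Φ (g ^ l * X ^ n) = 0 := by
    intro n
    induction n using Nat.strong_induction_on with
    | _ n ih =>
    rcases le_or_gt n g.natDegree with hn | hn
    · exact h0 n hn
    -- Applying the operator to `g ^ (l + 1) X ^ a` gives `g ^ l q` with `q` of degree `deg g + 1 +
    -- a` and nonzero leading coefficient. This is a recurrence expressing the value at `n` through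
    -- smaller exponents; it starts at `n = deg g + 1`, hence the `deg g + 1` initial values.
    obtain ⟨a, rfl⟩ : ∃ a, n = g.natDegree + 1 + a := ⟨n - (g.natDegree + 1), by omega⟩
    have hE' := hE (g ^ (l + 1) * X ^ a) ((dvd_pow_self g l.succ_ne_zero).mul_right _)
    set q : L[X] := C ((l : L) + 1) * (X ^ (a + 2) * derivative g) + C (a : L) * (X ^ (a + 1) * g) +
      (X ^ (a + 1) * g - X ^ a * g) with hq
    have h1 : X ^ 2 * derivative (g ^ (l + 1) * X ^ a) + (X - 1) * (g ^ (l + 1) * X ^ a) =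
        g ^ l * q := by
      rw [hq]
      rcases a with _ | a
      · simp [derivative_pow]
        ring
      · simp [derivative_pow]
        ring
    have hcoef : q.coeff (g.natDegree + 1 + a) = ((l : L) + 1) * g.natDegree + a + 1 := by
      have e1 : (X ^ (a + 2) * derivative g).coeff (g.natDegree + 1 + a) = (g.natDegree : L) := by
        rcases Nat.eq_zero_or_pos g.natDegree with h | h
        · have : derivative g = 0 := by
            rw [hg.natDegree_eq_zero.1 h]; simp
          simp [this, h]
        · rw [show g.natDegree + 1 + a = (g.natDegree - 1) + (a + 2) by omega, coeff_X_pow_mul,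
            coeff_derivative, Nat.sub_add_cancel h, hg.coeff_natDegree]
          push_cast [Nat.cast_sub h]
          ring
      have e2 : (X ^ (a + 1) * g).coeff (g.natDegree + 1 + a) = 1 := by
        rw [show g.natDegree + 1 + a = g.natDegree + (a + 1) by omega, coeff_X_pow_mul,
          hg.coeff_natDegree]
      have e3 : (X ^ a * g).coeff (g.natDegree + 1 + a) = 0 := by
        rw [show g.natDegree + 1 + a = (g.natDegree + 1) + a by omega, coeff_X_pow_mul,
          coeff_eq_zero_of_natDegree_lt (by omega)]
      simp only [hq, coeff_add, coeff_sub, coeff_C_mul, e1, e2, e3]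
      ring
    have hdeg : q.natDegree < g.natDegree + 1 + a + 1 := by
      rw [Nat.lt_succ_iff, natDegree_le_iff_coeff_eq_zero]
      intro N hN
      have e1 : (X ^ (a + 2) * derivative g).coeff N = 0 := by
        rw [show N = (N - (a + 2)) + (a + 2) by omega, coeff_X_pow_mul, coeff_derivative,
          coeff_eq_zero_of_natDegree_lt (by omega), zero_mul]
      have e2 : (X ^ (a + 1) * g).coeff N = 0 := by
        rw [show N = (N - (a + 1)) + (a + 1) by omega, coeff_X_pow_mul,
          coeff_eq_zero_of_natDegree_lt (by omega)]
      have e3 : (X ^ a * g).coeff N = 0 := by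
        rw [show N = (N - a) + a by omega, coeff_X_pow_mul,
          coeff_eq_zero_of_natDegree_lt (by omega)]
      simp only [hq, coeff_add, coeff_sub, coeff_C_mul, e1, e2, e3]
      simp
    rw [h1, q.as_sum_range' _ hdeg, Finset.mul_sum, map_sum, Finset.sum_range_succ,
      Finset.sum_eq_zero, zero_add, hcoef, ← C_mul_X_pow_eq_monomial, mul_left_comm,
      ← smul_eq_C_mul, map_smul, smul_eq_mul, mul_eq_zero] at hE'
    · refine hE'.resolve_left ?_
      have : (((l + 1) * g.natDegree + a + 1 : ℕ) : L) ≠ 0 := Nat.cast_ne_zero.2 (by omega)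
      push_cast at this
      exact this
    · intro i hi
      rw [← C_mul_X_pow_eq_monomial, mul_left_comm, ← smul_eq_C_mul, map_smul,
        ih i (Finset.mem_range.1 hi), smul_zero]
  rw [f.as_sum_range_C_mul_X_pow, Finset.mul_sum, map_sum]
  refine Finset.sum_eq_zero fun i _ => ?_
  rw [mul_left_comm, ← smul_eq_C_mul, map_smul, key, smul_zero]

/-- A functional killing `X ^ 2 f' + (X - 1) f` for all multiples `f` of `g`, where `g` is coprime
to `X ^ 2 g'`, is zero as soon as it vanishes on the ideal of some power of `g`. -/
theorem eq_zero_of_map_pow_mul_eq_zero [CharZero L] {Φ : L[X] →ₗ[L] L} {g : L[X]}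
    (hE : ∀ f, g ∣ f → Φ (X ^ 2 * derivative f + (X - 1) * f) = 0)
    (hcop : IsCoprime g (X ^ 2 * derivative g)) {l : ℕ} (h : ∀ f, Φ (g ^ l * f) = 0) : Φ = 0 := by
  induction l with
  | zero => ext n; simpa [monomial_one_right_eq_X_pow] using h (X ^ n)
  | succ l ih =>
    refine ih fun f => ?_
    obtain ⟨a, b, hab⟩ := hcop
    -- Modulo `g ^ (l + 1)` the operator applied to `g ^ (l + 1) b f` is `(l + 1) g ^ l X² g' b f`,
    -- and `b X² g' ≡ 1` modulo `g`. So the exponent of `g` can be lowered by one.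
    have h1 := hE (g ^ (l + 1) * (b * f)) ((dvd_pow_self g l.succ_ne_zero).mul_right _)
    have h2 : X ^ 2 * derivative (g ^ (l + 1) * (b * f)) + (X - 1) * (g ^ (l + 1) * (b * f)) =
        ((l : L) + 1) • (g ^ l * (X ^ 2 * derivative g * b * f)) +
          g ^ (l + 1) * (X ^ 2 * derivative (b * f) + (X - 1) * (b * f)) := by
      rw [derivative_mul, derivative_pow, smul_eq_C_mul]
      simp
      ring
    rw [h2, map_add, h, add_zero, map_smul, smul_eq_mul, mul_eq_zero] at h1
    have h3 := h1.resolve_left (by exact_mod_cast l.succ_ne_zero)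
    have h4 : g ^ l * f = g ^ (l + 1) * (a * f) + g ^ l * (X ^ 2 * derivative g * b * f) := by
      calc g ^ l * f = g ^ l * f * 1 := by ring
        _ = g ^ l * f * (a * g + b * (X ^ 2 * derivative g)) := by rw [hab]
        _ = _ := by ring
    rw [h4, map_add, h, h3, add_zero]

/-- Nonvanishing of one of the `m + 1` approximation forms. -/
theorem exists_factorialFunctional_ne_zero [CharZero L] {m : ℕ} {a : Fin m → L}
    (ha : Function.Injective a) (ha0 : ∀ j, a j ≠ 0) (b : Fin (m + 1) → L) (hb : ∃ i, b i ≠ 0)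
    (l : ℕ) :
    ∃ μ ≤ m, factorialFunctional
      (fun k => b 0 + ∑ j : Fin m, b j.succ * ∑ h ∈ Finset.range k, (h.factorial : L) * a j ^ h)
      ((∏ j, (X - C (a j))) ^ l * X ^ μ) ≠ 0 := by
  by_contra! hcon
  set Φ := factorialFunctional
      (fun k => b 0 + ∑ j : Fin m, b j.succ * ∑ h ∈ Finset.range k, (h.factorial : L) * a j ^ h)
  set g : L[X] := ∏ j, (X - C (a j)) with hgdef
  have hg : g.Monic := monic_prod_of_monic _ _ fun j _ => monic_X_sub_C _
  have hgdeg : g.natDegree = m := by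
    rw [hgdef, natDegree_finsetProd_X_sub_C_eq_card]; simp
  have hop (f : L[X]) : Φ (X ^ 2 * derivative f + (X - 1) * f) =
      ∑ j : Fin m, b j.succ * f.eval (a j) :=
    factorialFunctional_euler_operator _ _ _ f
  have hE (f : L[X]) (hf : g ∣ f) : Φ (X ^ 2 * derivative f + (X - 1) * f) = 0 := by
    rw [hop]
    refine Finset.sum_eq_zero fun j _ => ?_
    obtain ⟨q, rfl⟩ := (Finset.dvd_prod_of_mem (fun j => X - C (a j)) (Finset.mem_univ j)).trans hf
    simp
  have hcop : IsCoprime g (X ^ 2 * derivative g) := by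
    refine IsCoprime.mul_right (IsCoprime.pow_right ?_) (separable_prod_X_sub_C_iff.2 ha)
    refine IsCoprime.prod_left fun j _ => ?_
    have := isCoprime_X_sub_C_of_isUnit_sub (a := a j) (b := 0) (by simpa using ha0 j)
    simpa using this
  have hΦ : Φ = 0 := eq_zero_of_map_pow_mul_eq_zero hE hcop
    (map_pow_mul_eq_zero hg hE fun μ hμ => hcon μ (hgdeg ▸ hμ))
  obtain ⟨i, hi⟩ := hb
  refine hi ?_
  induction i using Fin.cases with
  | zero =>
    have h := factorialFunctional_X_pow
      (fun k => b 0 + ∑ j : Fin m, b j.succ * ∑ h ∈ Finset.range k, (h.factorial : L) * a j ^ h) 0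
    change Φ _ = _ at h
    rw [hΦ] at h
    simpa using h.symm
  | succ i =>
    -- A Lagrange-type polynomial, vanishing at every node except `a i`, isolates `b i.succ`.
    have h := hop (∏ j ∈ Finset.univ.erase i, (X - C (a j)))
    rw [hΦ, LinearMap.zero_apply, Finset.sum_eq_single i, eval_prod] at h
    · refine (mul_eq_zero.1 h.symm).resolve_right (Finset.prod_ne_zero_iff.2 fun j hj => ?_)
      simpa [sub_eq_zero] using fun h => (Finset.ne_of_mem_erase hj) (ha h).symm
    · intro j _ hj
      rw [eval_prod, Finset.prod_eq_zero (Finset.mem_erase.2 ⟨hj, Finset.mem_univ j⟩) (by simp),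
        mul_zero]
    · simp

end Functional


/-! ### Archimedean estimate by majorants. -/

section Archimedean

open Polynomial

variable {L : Type*} [Field L]

/-- `c` bounds the effect of multiplication by `p` on functionals of growth `A ^ k`. -/
def IsMajorant (v : AbsoluteValue L ℝ) (A : ℝ) (p : L[X]) (c : ℝ) : Prop :=
  ∀ (Φ : L[X] →ₗ[L] L) (B : ℝ), (∀ k, v (Φ (X ^ k)) ≤ B * A ^ k) →
    ∀ k, v (Φ (p * X ^ k)) ≤ B * c * A ^ k

variable {v : AbsoluteValue L ℝ} {A : ℝ}

theorem isMajorant_one : IsMajorant v A (1 : L[X]) 1 := fun Φ B h k => by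
  simpa using h k

/-- Composing `Φ` with multiplication by `p` gives a functional of the same growth with `B` replaced
by `B * c`, to which the majorant of `q` applies. This is why the definition ranges over all
functionals. -/
theorem IsMajorant.mul {p q : L[X]} {c d : ℝ} (hp : IsMajorant v A p c)
    (hq : IsMajorant v A q d) : IsMajorant v A (p * q) (c * d) := fun Φ B h k => by
  have := hq (Φ ∘ₗ LinearMap.mulLeft L p) (B * c) (fun k => by simpa using hp Φ B h k) k
  simpa [mul_assoc] using this

theorem IsMajorant.pow {p : L[X]} {c : ℝ} (hp : IsMajorant v A p c) (n : ℕ) :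
    IsMajorant v A (p ^ n) (c ^ n) := by
  induction n with
  | zero => simpa using isMajorant_one
  | succ n ih => rw [pow_succ, pow_succ]; exact ih.mul hp

theorem IsMajorant.prod {ι : Type*} (s : Finset ι) {p : ι → L[X]} {c : ι → ℝ}
    (h : ∀ i, IsMajorant v A (p i) (c i)) : IsMajorant v A (∏ i ∈ s, p i) (∏ i ∈ s, c i) := by
  classical
  induction s using Finset.induction_on with
  | empty => simpa using isMajorant_one
  | insert i s hi ih => rw [Finset.prod_insert hi, Finset.prod_insert hi]; exact (h i).mul ih

theorem isMajorant_X : IsMajorant v A (X : L[X]) A := fun Φ B h k => by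
  rw [← pow_succ', mul_assoc, ← pow_succ']
  exact h (k + 1)

theorem isMajorant_X_sub_C (a : L) : IsMajorant v A (X - C a) (v a + A) := fun Φ B h k => by
  rw [sub_mul, ← pow_succ', ← smul_eq_C_mul, map_sub, map_smul, smul_eq_mul]
  calc v (Φ (X ^ (k + 1)) - a * Φ (X ^ k)) ≤ v (Φ (X ^ (k + 1))) + v (a * Φ (X ^ k)) :=
        (v.sub_le_add _ _)
    _ ≤ B * A ^ (k + 1) + v a * (B * A ^ k) := by
        rw [v.map_mul]
        have := v.nonneg a
        gcongr
        exacts [h _, h _]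
    _ = _ := by ring

theorem sum_factorial_le (k : ℕ) : ∑ h ∈ Finset.range k, h.factorial ≤ k.factorial := by
  induction k with
  | zero => simp
  | succ k ih =>
    rw [Finset.sum_range_succ]
    rcases k with _ | k
    · simp
    · rw [Nat.factorial_succ (k + 1)]
      nlinarith [Nat.factorial_pos (k + 1)]

/-- Archimedean bound for the approximation forms. -/
theorem abv_factorialFunctional_le {m : ℕ} (hv : ∀ n : ℕ, v (n : L) = n) (hA : 1 ≤ A)
    {a : Fin m → L} (ha : ∀ j, v (a j) ≤ A) {b : Fin (m + 1) → L} {B : ℝ} (hb : ∀ i, v (b i) ≤ B)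
    (l μ : ℕ) :
    v (factorialFunctional
      (fun k => b 0 + ∑ j : Fin m, b j.succ * ∑ h ∈ Finset.range k, (h.factorial : L) * a j ^ h)
      ((∏ j, (X - C (a j))) ^ l * X ^ μ)) ≤
      ((m : ℝ) + 1) * B * ((∏ j, (v (a j) + A)) ^ l * A ^ μ) := by
  have hB : 0 ≤ B := (v.nonneg _).trans (hb 0)
  have h1 := ((IsMajorant.prod (v := v) (A := A) Finset.univ
    fun j => isMajorant_X_sub_C (a j)).pow l).mul (isMajorant_X.pow μ)
  have h2 : ∀ k, v (factorialFunctional (fun k => b 0 + ∑ j : Fin m, b j.succ *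
      ∑ h ∈ Finset.range k, (h.factorial : L) * a j ^ h) (X ^ k)) ≤ (((m : ℝ) + 1) * B) * A ^ k := by
    intro k
    have hf : (0 : ℝ) < k.factorial := by exact_mod_cast k.factorial_pos
    rw [factorialFunctional_X_pow, map_div₀, hv, div_le_iff₀ hf]
    have hAk : 1 ≤ A ^ k := one_le_pow₀ hA
    have hfk : (1 : ℝ) ≤ k.factorial := by exact_mod_cast k.factorial_pos
    have hS (j : Fin m) : v (∑ h ∈ Finset.range k, (h.factorial : L) * a j ^ h) ≤
        A ^ k * k.factorial := by
      calc _ ≤ ∑ h ∈ Finset.range k, v ((h.factorial : L) * a j ^ h) := v.sum_le _ _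
        _ ≤ ∑ h ∈ Finset.range k, A ^ k * (h.factorial : ℝ) := by
          refine Finset.sum_le_sum fun h hh => ?_
          rw [v.map_mul, v.map_pow, hv, mul_comm]
          gcongr
          calc v (a j) ^ h ≤ A ^ h := by
                have := v.nonneg (a j)
                gcongr
                exact ha j
            _ ≤ A ^ k := pow_le_pow_right₀ hA (Finset.mem_range.1 hh).le
        _ ≤ _ := by
          rw [← Finset.mul_sum]
          gcongr
          exact_mod_cast sum_factorial_le k
    calc _ ≤ v (b 0) + v (∑ j : Fin m, b j.succ *
          ∑ h ∈ Finset.range k, (h.factorial : L) * a j ^ h) := v.add_le _ _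
      _ ≤ B * (A ^ k * k.factorial) + ∑ j : Fin m, B * (A ^ k * k.factorial) := by
        gcongr
        · calc v (b 0) ≤ B * (1 * 1) := by simpa using hb 0
            _ ≤ _ := by gcongr
        · refine (v.sum_le _ _).trans (Finset.sum_le_sum fun j _ => ?_)
          rw [v.map_mul]
          exact mul_le_mul (hb _) (hS j) (v.nonneg _) hB
      _ = _ := by
        simp
        ring
  simpa using h1 _ _ h2 0

end Archimedean

/-! ### Non-Archimedean estimate of the remainders. -/

section Finite

open Polynomial

variable {L : Type*}

theorem map_factorialFunctional {K' : Type*} [Field K'] [Field L] (ψ : K' →+* L) (w : ℕ → K')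
    (f : K'[X]) :
    ψ (factorialFunctional w f) = factorialFunctional (fun k => ψ (w k)) (f.map ψ) := by
  rw [factorialFunctional_eq_sum_range w f (Nat.lt_succ_self _),
    factorialFunctional_eq_sum_range _ (f.map ψ)
      (Nat.lt_succ_of_le (natDegree_map_le (p := f) (f := ψ)))]
  simp

/-- After multiplication by `n! a ^ n` the right side becomes `∑ (n + k)! / k! * f_k * a ^ (n + k)`,
the sum of the `n`-th terms of the series tails weighted by `f`. The left side shows that it
vanishes when `n < l` and `f` has a zero of order `l` at `a`. -/
theorem eval_hasseDeriv_X_pow_mul [CommRing L] (n : ℕ) (f : L[X]) (a : L) {M : ℕ}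
    (hf : f.natDegree < M) :
    (hasseDeriv n (X ^ n * f)).eval a =
      ∑ k ∈ Finset.range M, ((n + k).choose n : L) * f.coeff k * a ^ k := by
  conv_lhs => rw [f.as_sum_range' M hf]
  rw [Finset.mul_sum, map_sum, eval_finsetSum]
  refine Finset.sum_congr rfl fun k _ => ?_
  rw [X_pow_mul_monomial, hasseDeriv_monomial, eval_monomial, add_comm k n, Nat.add_sub_cancel_left]

theorem eval_hasseDeriv_eq_zero [CommRing L] {n l : ℕ} (hn : n < l) {f : L[X]} {a : L}
    (hf : (X - C a) ^ l ∣ f) : (hasseDeriv n f).eval a = 0 := by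
  obtain ⟨q, rfl⟩ := hf
  rw [← taylor_coeff, taylor_mul, taylor_pow, map_sub, taylor_X, taylor_C, add_sub_cancel_right,
    coeff_X_pow_mul', if_neg (by omega)]

variable [NormedField L] [IsUltrametricDist L] [CharZero L]

theorem norm_factorial_mul_factorialFunctional_le {M : ℕ} {f : L[X]} (hM : f.natDegree ≤ M)
    (hf : ∀ k, ‖f.coeff k‖ ≤ 1) {w : ℕ → L} {c : ℝ} (hw : ∀ k, ‖w k‖ ≤ c) :
    ‖(M.factorial : L) * factorialFunctional w f‖ ≤ c := by
  have hc : 0 ≤ c := (norm_nonneg _).trans (hw 0)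
  rw [factorialFunctional_eq_sum_range w f (Nat.lt_succ_of_le hM), Finset.mul_sum]
  refine IsUltrametricDist.norm_sum_le_of_forall_le_of_nonneg hc fun k hk => ?_
  obtain ⟨q, hq⟩ := Nat.factorial_dvd_factorial (Nat.lt_succ_iff.1 (Finset.mem_range.1 hk))
  have h0 : (k.factorial : L) ≠ 0 := Nat.cast_ne_zero.2 k.factorial_ne_zero
  have h1 : (M.factorial : L) * (w k / k.factorial * f.coeff k) = q * w k * f.coeff k := by
    rw [hq, Nat.cast_mul]
    field_simp
  rw [h1, norm_mul, norm_mul]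
  calc _ ≤ 1 * c * 1 := by
        gcongr
        exacts [IsUltrametricDist.norm_natCast_le_one L q, hw k, hf k]
    _ = c := by ring

/-- Non-Archimedean bound for the remainder of one series. -/
theorem norm_remainder_le {M l : ℕ} {f : L[X]} (hM : f.natDegree ≤ M)
    (hf : ∀ k, ‖f.coeff k‖ ≤ 1) {a F : L} (ha : ‖a‖ ≤ 1)
    (hF : HasSum (fun n : ℕ => (n.factorial : L) * a ^ n) F) (hdvd : (X - C a) ^ l ∣ f) :
    ‖(M.factorial : L) * factorialFunctional
      (fun k => F - ∑ h ∈ Finset.range k, (h.factorial : L) * a ^ h) f‖ ≤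
      ‖((M.factorial * l.factorial : ℕ) : L)‖ := by
  have h1 : HasSum (fun n : ℕ => (n.factorial : L) * a ^ n * (hasseDeriv n (X ^ n * f)).eval a)
      (factorialFunctional (fun k => F - ∑ h ∈ Finset.range k, (h.factorial : L) * a ^ h) f) := by
    rw [factorialFunctional_eq_sum_range _ f (Nat.lt_succ_of_le hM)]
    have h2 : HasSum (fun n : ℕ => ∑ k ∈ Finset.range (M + 1),
        ((n + k).factorial : L) * a ^ (n + k) / k.factorial * f.coeff k)
        (∑ k ∈ Finset.range (M + 1),
          (F - ∑ h ∈ Finset.range k, (h.factorial : L) * a ^ h) / k.factorial * f.coeff k) :=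
      hasSum_sum fun k _ => (((hasSum_nat_add_iff' k).2 hF).div_const _).mul_right _
    convert h2 using 1
    funext n
    rw [eval_hasseDeriv_X_pow_mul n f a (Nat.lt_succ_of_le hM), Finset.mul_sum]
    refine Finset.sum_congr rfl fun k _ => ?_
    have h0 : (k.factorial : L) ≠ 0 := Nat.cast_ne_zero.2 k.factorial_ne_zero
    have h3 := Nat.add_choose_mul_factorial_mul_factorial n k
    have h4 : ((n + k).factorial : L) = (n + k).choose n * n.factorial * k.factorial := by
      rw [← h3, Nat.choose_symm_add]; push_cast; ring
    rw [h4, pow_add]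
    field_simp
  rw [Nat.cast_mul, norm_mul, norm_mul]
  gcongr
  refine le_of_tendsto (h1.norm) (Filter.Eventually.of_forall fun s => ?_)
  refine IsUltrametricDist.norm_sum_le_of_forall_le_of_nonneg (norm_nonneg _) fun n _ => ?_
  rcases lt_or_ge n l with hn | hn
  · rw [eval_hasseDeriv_eq_zero hn (hdvd.mul_left _)]
    simp
  · obtain ⟨q, hq⟩ := Nat.factorial_dvd_factorial hn
    have h5 : ‖(hasseDeriv n (X ^ n * f)).eval a‖ ≤ 1 := by
      rw [eval_hasseDeriv_X_pow_mul n f a (Nat.lt_succ_of_le hM)]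
      refine IsUltrametricDist.norm_sum_le_of_forall_le_of_nonneg zero_le_one fun k _ => ?_
      rw [norm_mul, norm_mul, norm_pow]
      exact mul_le_one₀ (mul_le_one₀ (IsUltrametricDist.norm_natCast_le_one L _) (norm_nonneg _)
        (hf k)) (by positivity) (pow_le_one₀ (norm_nonneg _) ha)
    rw [hq, Nat.cast_mul, norm_mul, norm_mul, norm_mul, norm_pow]
    calc _ ≤ ‖(l.factorial : L)‖ * 1 * 1 * 1 := by
          gcongr
          exacts [IsUltrametricDist.norm_natCast_le_one L q, pow_le_one₀ (norm_nonneg _) ha]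
      _ = _ := by ring

/-- Non-Archimedean bound for the approximation forms. -/
theorem norm_form_le_max {m M l : ℕ} {f : L[X]} (hM : f.natDegree ≤ M)
    (hf : ∀ k, ‖f.coeff k‖ ≤ 1) {a F : Fin m → L} (ha : ∀ j, ‖a j‖ ≤ 1)
    (hF : ∀ j, HasSum (fun n : ℕ => (n.factorial : L) * a j ^ n) (F j))
    (hdvd : ∀ j, (X - C (a j)) ^ l ∣ f) {b : Fin (m + 1) → L} (hb : ∀ i, ‖b i‖ ≤ 1) :
    ‖(M.factorial : L) * factorialFunctional
      (fun k => b 0 + ∑ j : Fin m, b j.succ * ∑ h ∈ Finset.range k, (h.factorial : L) * a j ^ h) f‖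
      ≤ max ‖b 0 + ∑ j : Fin m, b j.succ * F j‖ ‖((M.factorial * l.factorial : ℕ) : L)‖ := by
  have h1 : (M.factorial : L) * factorialFunctional
      (fun k => b 0 + ∑ j : Fin m, b j.succ * ∑ h ∈ Finset.range k, (h.factorial : L) * a j ^ h) f =
      (M.factorial : L) * factorialFunctional (fun _ => b 0 + ∑ j : Fin m, b j.succ * F j) f -
      ∑ j : Fin m, b j.succ * ((M.factorial : L) * factorialFunctional
        (fun k => F j - ∑ h ∈ Finset.range k, (h.factorial : L) * a j ^ h) f) := by
    -- Partial sum equals full sum minus tail: the full sums assemble into the constant sequence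
    -- `Λ`, the tails into the remainders.
    simp only [factorialFunctional_eq_sum_range _ f (Nat.lt_succ_of_le hM), Finset.mul_sum]
    rw [Finset.sum_comm, ← Finset.sum_sub_distrib]
    refine Finset.sum_congr rfl fun k _ => ?_
    have h2 : ∀ j : Fin m, b j.succ * ((M.factorial : L) *
        ((F j - ∑ h ∈ Finset.range k, (h.factorial : L) * a j ^ h) / k.factorial * f.coeff k)) =
        (M.factorial : L) * ((b j.succ * F j -
          b j.succ * ∑ h ∈ Finset.range k, (h.factorial : L) * a j ^ h) /
            k.factorial * f.coeff k) := fun j => by ring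
    simp only [h2, ← Finset.mul_sum, ← Finset.sum_mul, ← Finset.sum_div, Finset.sum_sub_distrib]
    ring
  rw [h1, sub_eq_add_neg]
  refine (IsUltrametricDist.norm_add_le_max _ _).trans (max_le_max ?_ ?_)
  · exact norm_factorial_mul_factorialFunctional_le hM hf fun _ => le_rfl
  · rw [norm_neg]
    refine IsUltrametricDist.norm_sum_le_of_forall_le_of_nonneg (norm_nonneg _) fun j _ => ?_
    rw [norm_mul]
    calc _ ≤ 1 * ‖((M.factorial * l.factorial : ℕ) : L)‖ := by
          gcongr
          exacts [hb _, norm_remainder_le hM hf (ha j) (hF j) (hdvd j)]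
      _ = _ := one_mul _

theorem norm_form_le_one {m M : ℕ} {f : L[X]} (hM : f.natDegree ≤ M)
    (hf : ∀ k, ‖f.coeff k‖ ≤ 1) {a : Fin m → L} (ha : ∀ j, ‖a j‖ ≤ 1)
    {b : Fin (m + 1) → L} (hb : ∀ i, ‖b i‖ ≤ 1) :
    ‖(M.factorial : L) * factorialFunctional
      (fun k => b 0 + ∑ j : Fin m, b j.succ * ∑ h ∈ Finset.range k, (h.factorial : L) * a j ^ h) f‖
      ≤ 1 := by
  refine norm_factorial_mul_factorialFunctional_le hM hf fun k => ?_
  refine (IsUltrametricDist.norm_add_le_max _ _).trans (max_le (hb 0) ?_)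
  refine IsUltrametricDist.norm_sum_le_of_forall_le_of_nonneg zero_le_one fun j _ => ?_
  rw [norm_mul]
  refine mul_le_one₀ (hb _) (norm_nonneg _) ?_
  refine IsUltrametricDist.norm_sum_le_of_forall_le_of_nonneg zero_le_one fun h _ => ?_
  rw [norm_mul, norm_pow]
  exact mul_le_one₀ (IsUltrametricDist.norm_natCast_le_one L _) (by positivity)
    (pow_le_one₀ (norm_nonneg _) (ha j))

end Finite


/-! ### Contribution of small primes to factorials. -/

section Primes

theorem sub_one_mul_factorization_factorial_le {p : ℕ} (hp : p.Prime) (n : ℕ) :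
    (p - 1) * n.factorial.factorization p ≤ n := by
  have : Fact p.Prime := ⟨hp⟩
  rw [Nat.factorization_def _ hp, sub_one_mul_padicValNat_factorial]
  exact Nat.sub_le _ _

theorem pow_factorization_factorial_le_two_pow {p : ℕ} (hp : p.Prime) (n : ℕ) :
    p ^ n.factorial.factorization p ≤ 2 ^ n := by
  calc p ^ n.factorial.factorization p ≤ (2 ^ (p - 1)) ^ n.factorial.factorization p := by
        gcongr
        have := Nat.lt_two_pow_self (n := p - 1)
        have := hp.pos
        omega
    _ = 2 ^ ((p - 1) * n.factorial.factorization p) := by rw [pow_mul]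
    _ ≤ 2 ^ n := Nat.pow_le_pow_right two_pos (sub_one_mul_factorization_factorial_le hp n)

theorem pow_factorization_factorial_le_exp {p : ℕ} (hp : p.Prime) (n : ℕ) :
    (p : ℝ) ^ n.factorial.factorization p ≤ Real.exp (n * (Real.log p / (p - 1))) := by
  have h1 : (1 : ℝ) < p := by exact_mod_cast hp.one_lt
  have h2 : ((p : ℝ) - 1) * n.factorial.factorization p ≤ n := by
    have := sub_one_mul_factorization_factorial_le hp n
    have h3 : (((p - 1) * n.factorial.factorization p : ℕ) : ℝ) ≤ n := by exact_mod_cast this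
    rwa [Nat.cast_mul, Nat.cast_sub hp.one_lt.le, Nat.cast_one] at h3
  rw [← Real.log_le_iff_le_exp (by positivity), Real.log_pow, mul_div_assoc',
    le_div_iff₀ (by linarith)]
  nlinarith [Real.log_pos h1]

/-- The maximum of `log t / t` is `1 / e`; with `t = √x` this gives the constant `2 / e < 0.7358`.
-/
theorem log_le_mul_sqrt {x : ℝ} (hx : 0 < x) : Real.log x ≤ 0.7358 * √x := by
  have hs : 0 < √x := Real.sqrt_pos.2 hx
  have h1 : Real.log x = 2 * Real.log (√x) := by
    rw [Real.log_sqrt hx.le]; ring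
  have h2 : Real.log (√x) ≤ √x * Real.exp (-1) := by
    rw [Real.log_le_iff_le_exp hs]
    have h := Real.add_one_le_exp (√x * Real.exp (-1) - 1)
    rw [Real.exp_sub] at h
    rw [sub_add_cancel, le_div_iff₀ (Real.exp_pos 1), mul_assoc, ← Real.exp_add] at h
    simpa using h
  have h3 : Real.exp (-1) ≤ 0.3679 := by
    rw [Real.exp_neg, inv_le_comm₀ (Real.exp_pos 1) (by norm_num)]
    have := Real.exp_one_gt_d9
    norm_num at this ⊢
    linarith
  nlinarith

/-- The right side telescopes over odd `x`. By concavity `√x + √(x - 2) ≤ 2 √(x - 1)`, so `√x - √(x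
- 2) ≥ 1 / √(x - 1)`. -/
theorem log_div_sub_one_le {x : ℝ} (hx : 3 ≤ x) :
    Real.log x / (x - 1) ≤ 0.92 * (√x - √(x - 2)) := by
  have h1 := log_le_mul_sqrt (show 0 < x by linarith)
  set u := √x with hu
  set t := √(x - 2) with ht
  set r := √(x - 1) with hr
  have hu2 : u ^ 2 = x := Real.sq_sqrt (by linarith)
  have ht2 : t ^ 2 = x - 2 := Real.sq_sqrt (by linarith)
  have hr2 : r ^ 2 = x - 1 := Real.sq_sqrt (by linarith)
  have hu0 : 0 ≤ u := Real.sqrt_nonneg _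
  have ht0 : 0 ≤ t := Real.sqrt_nonneg _
  have hr0 : 0 < r := Real.sqrt_pos.2 (by linarith)
  have h2 : 0.7358 * u ≤ 0.92 * r := by
    refine abs_le_of_sq_le_sq' ?_ (by positivity) |>.2
    nlinarith
  have h3 : u + t ≤ 2 * r := by
    refine abs_le_of_sq_le_sq' ?_ (by positivity) |>.2
    nlinarith [sq_nonneg (u - t)]
  have h4 : 1 ≤ r * (u - t) := by
    have h5 : (u - t) * (u + t) = 2 := by nlinarith
    have h6 : 0 ≤ u - t := by nlinarith
    nlinarith
  rw [div_le_iff₀ (by linarith), ← hr2]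
  nlinarith

/-- Chebyshev-type bound for the exponents of small primes in factorials. -/
theorem sum_primes_log_div_le {n : ℕ} (hn : 1 ≤ n) :
    ∑ p ∈ (Finset.range (n + 1)).filter Nat.Prime, Real.log p / ((p : ℝ) - 1) ≤ 0.92 * √n := by
  -- Beyond `2` only odd numbers can be prime, so the induction advances by two.
  have key : ∀ k : ℕ, ∑ p ∈ (Finset.range (2 * k + 3)).filter Nat.Prime,
      Real.log p / ((p : ℝ) - 1) ≤ 0.92 * √(2 * k + 1 : ℝ) := by
    intro k
    induction k with
    | zero =>
      have : (Finset.range (2 * 0 + 3)).filter Nat.Prime = {2} := by decide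
      rw [this]
      have := Real.log_two_lt_d9
      norm_num at this ⊢
      linarith
    | succ k ih =>
      have h1 : ¬ (2 * k + 4).Prime := by
        intro h
        have := (Nat.prime_dvd_prime_iff_eq Nat.prime_two h).1 ⟨k + 2, by ring⟩
        omega
      have h2 := log_div_sub_one_le (x := 2 * k + 3) (by linarith [(Nat.cast_nonneg k : (0 : ℝ) ≤ k)])
      have h3 : √(2 * k + 1 : ℝ) ≤ √(2 * k + 3 : ℝ) := Real.sqrt_le_sqrt (by linarith)
      rw [show 2 * (k + 1) + 3 = 2 * k + 3 + 1 + 1 by ring, Finset.range_add_one,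
        Finset.filter_insert, if_neg h1, Finset.range_add_one, Finset.filter_insert]
      have h4 : (2 * (k + 1 : ℕ) + 1 : ℝ) = 2 * k + 3 := by push_cast; ring
      have h5 : (2 * k + 3 - 2 : ℝ) = 2 * k + 1 := by ring
      rw [h5] at h2
      rw [h4]
      split_ifs with hp
      · rw [Finset.sum_insert (by simp)]
        push_cast
        linarith
      · linarith
  obtain ⟨k, hk⟩ : ∃ k, n = 2 * k + 1 ∨ n = 2 * k + 2 := ⟨(n - 1) / 2, by omega⟩
  calc _ ≤ ∑ p ∈ (Finset.range (2 * k + 3)).filter Nat.Prime, Real.log p / ((p : ℝ) - 1) := by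
        refine Finset.sum_le_sum_of_subset_of_nonneg
          (Finset.filter_subset_filter _ (Finset.range_subset_range.2 (by omega))) fun p hp _ => ?_
        have h1 : (1 : ℝ) < p := by exact_mod_cast (Finset.mem_filter.1 hp).2.one_lt
        exact div_nonneg (Real.log_nonneg h1.le) (by linarith)
    _ ≤ _ := key k
    _ ≤ _ := by
      gcongr
      have : 2 * k + 1 ≤ n := by omega
      exact_mod_cast this

/-- The part of `n` composed of primes at most `u`. -/
def smallPart (u n : ℕ) : ℕ := ∏ p ∈ n.primeFactors.filter (· ≤ u), p ^ n.factorization p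

/-- The part of `n` composed of primes exceeding `u`. -/
def largePart (u n : ℕ) : ℕ := ∏ p ∈ n.primeFactors.filter (¬ · ≤ u), p ^ n.factorization p

theorem smallPart_mul_largePart (u : ℕ) {n : ℕ} (hn : n ≠ 0) :
    smallPart u n * largePart u n = n := by
  rw [smallPart, largePart, Finset.prod_filter_mul_prod_filter_not]
  exact Nat.prod_factorization_pow_eq_self hn

theorem prime_dvd_largePart {u n p : ℕ} (hp : p.Prime) (h : p ∣ largePart u n) :
    u < p ∧ p ∣ n := by
  obtain ⟨q, hq, hpq⟩ := (hp.prime.dvd_finsetProd_iff _).1 h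
  obtain ⟨hq1, hq2⟩ := Finset.mem_filter.1 hq
  have hq3 := Nat.prime_of_mem_primeFactors hq1
  have := (Nat.prime_dvd_prime_iff_eq hp hq3).1 (hp.dvd_of_dvd_pow hpq)
  subst this
  exact ⟨not_le.1 hq2, Nat.dvd_of_mem_primeFactors hq1⟩

theorem smallPart_factorial_mul_factorial_le (M l : ℕ) {u : ℕ} (hu : 1 ≤ u) :
    (smallPart u (M.factorial * l.factorial) : ℝ) ≤
      Real.exp (((M : ℝ) + l) * (0.92 * √u)) := by
  have hpos (p : ℕ) (hp : p.Prime) : 0 ≤ Real.log p / ((p : ℝ) - 1) := by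
    have h1 : (1 : ℝ) < p := by exact_mod_cast hp.one_lt
    exact div_nonneg (Real.log_nonneg h1.le) (by linarith)
  rw [smallPart]
  push_cast
  calc _ ≤ ∏ p ∈ (M.factorial * l.factorial).primeFactors.filter (· ≤ u),
        Real.exp (((M : ℝ) + l) * (Real.log p / (p - 1))) := by
        refine Finset.prod_le_prod (fun _ _ => by positivity) fun p hp => ?_
        have hp' := Nat.prime_of_mem_primeFactors (Finset.mem_filter.1 hp).1
        rw [Nat.factorization_mul M.factorial_ne_zero l.factorial_ne_zero, Finsupp.add_apply,
          pow_add, add_mul, Real.exp_add]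
        exact mul_le_mul (pow_factorization_factorial_le_exp hp' M)
          (pow_factorization_factorial_le_exp hp' l) (by positivity) (by positivity)
    _ = Real.exp (((M : ℝ) + l) * ∑ p ∈ (M.factorial * l.factorial).primeFactors.filter (· ≤ u),
        Real.log p / (p - 1)) := by rw [← Real.exp_sum, Finset.mul_sum]
    _ ≤ _ := by
      gcongr
      refine le_trans ?_ (sum_primes_log_div_le hu)
      refine Finset.sum_le_sum_of_subset_of_nonneg (fun p hp => ?_) fun p hp _ =>
        hpos p (Finset.mem_filter.1 hp).2
      obtain ⟨h1, h2⟩ := Finset.mem_filter.1 hp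
      exact Finset.mem_filter.2 ⟨Finset.mem_range.2 (by omega), Nat.prime_of_mem_primeFactors h1⟩

end Primes


variable {K : Type*} [Field K] [NumberField K]

/-! ### Normalised Archimedean size of the forms. -/

section InfinitePlaces

theorem finrank_pos_real : (0 : ℝ) < Module.finrank ℚ K := by
  exact_mod_cast Module.finrank_pos

theorem infNorm_nonneg (w : InfinitePlace K) (x : K) : 0 ≤ infNorm w x :=
  Real.rpow_nonneg (apply_nonneg w x) _

theorem infNorm_eq_pow_rpow (w : InfinitePlace K) (x : K) :
    infNorm w x = (w x ^ w.mult) ^ (1 / (Module.finrank ℚ K : ℝ)) := by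
  rw [infNorm, ← Real.rpow_natCast, ← Real.rpow_mul (apply_nonneg w x), mul_one_div]

theorem prod_infNorm (x : K) : ∏ w : InfinitePlace K, infNorm w x =
    (∏ w : InfinitePlace K, w x ^ w.mult) ^ (1 / (Module.finrank ℚ K : ℝ)) := by
  simp_rw [infNorm_eq_pow_rpow]
  exact Real.finsetProd_rpow _ _ (fun w _ => pow_nonneg (apply_nonneg w x) _) _

theorem infNorm_natCast (w : InfinitePlace K) (n : ℕ) :
    infNorm w (n : K) = (n : ℝ) ^ ((w.mult : ℝ) / Module.finrank ℚ K) := by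
  rw [infNorm, ← InfinitePlace.norm_embedding_eq]
  simp

theorem prod_natCast_pow_mult (n : ℕ) :
    ∏ w : InfinitePlace K, (w (n : K)) ^ w.mult = (n : ℝ) ^ Module.finrank ℚ K := by
  have h (w : InfinitePlace K) : w (n : K) = n := by
    rw [← InfinitePlace.norm_embedding_eq]; simp
  simp_rw [h, Finset.prod_pow_eq_pow_sum, InfinitePlace.sum_mult_eq]

theorem prod_infNorm_natCast (n : ℕ) : ∏ w : InfinitePlace K, infNorm w (n : K) = n := by
  rw [prod_infNorm, prod_natCast_pow_mult, ← Real.rpow_natCast,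
    ← Real.rpow_mul (Nat.cast_nonneg n), mul_one_div_cancel finrank_pos_real.ne', Real.rpow_one]

theorem mult_le_finrank (w : InfinitePlace K) : w.mult ≤ Module.finrank ℚ K := by
  rw [← InfinitePlace.sum_mult_eq]
  exact Finset.single_le_sum (f := fun w : InfinitePlace K => w.mult) (fun _ _ => Nat.zero_le _)
    (Finset.mem_univ w)

theorem one_le_max_sup {m : ℕ} (w : InfinitePlace K) (α : Fin m → 𝓞 K) :
    1 ≤ max 1 (⨆ j, infNorm w (α j : K)) := le_max_left _ _

theorem one_le_c₁ {m : ℕ} (α : Fin m → 𝓞 K) : 1 ≤ c₁ α := by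
  refine Finset.one_le_prod fun w _ => ?_
  have h := one_le_max_sup w α
  refine one_le_mul_of_one_le_of_one_le (one_le_pow₀ h) (Finset.one_le_prod fun i _ => ?_)
  linarith [infNorm_nonneg w (α i : K)]

/-- The approximation form of order `l` and index `μ`. -/
noncomputable def approxForm {m : ℕ} (α : Fin m → 𝓞 K) (b : Fin (m + 1) → 𝓞 K) (l μ : ℕ) : K :=
  ((m * l + μ).factorial : K) * factorialFunctional
    (fun k => (b 0 : K) + ∑ j : Fin m, (b j.succ : K) *
      ∑ h ∈ Finset.range k, (h.factorial : K) * (α j : K) ^ h)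
    ((∏ j, (Polynomial.X - Polynomial.C (α j : K))) ^ l * Polynomial.X ^ μ)

/-- The majorant estimate needs the triangle inequality of `w`, while `infNorm` is its power with
exponent `θ ≤ 1`. So it is applied with the `θ`-th roots of `A'` and `B'`, and subadditivity of `t ↦
t ^ θ` brings the result back. -/
theorem infNorm_approxForm_le {m : ℕ} (α : Fin m → 𝓞 K) (b : Fin (m + 1) → 𝓞 K) {l μ : ℕ}
    (hl : 1 ≤ l) (hμ : μ ≤ m) (w : InfinitePlace K) :
    infNorm w (approxForm α b l μ) ≤
      infNorm w (((m * l + μ).factorial * (m + 1) : ℕ) : K) * (⨆ i, infNorm w (b i : K)) *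
        ((max 1 (⨆ j, infNorm w (α j : K))) ^ m *
          ∏ i, (infNorm w (α i : K) + max 1 (⨆ j, infNorm w (α j : K)))) ^ l := by
  set A' := max 1 (⨆ j, infNorm w (α j : K)) with hA'
  set B' := ⨆ i, infNorm w (b i : K) with hB'
  set θ : ℝ := (w.mult : ℝ) / Module.finrank ℚ K with hθ
  have hθ0 : 0 < θ := div_pos (by exact_mod_cast w.mult_pos) finrank_pos_real
  have hθ1 : θ ≤ 1 := by
    rw [hθ, div_le_one finrank_pos_real]
    exact_mod_cast mult_le_finrank w
  have hA1 : 1 ≤ A' := le_max_left _ _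
  have hA0 : 0 ≤ A' := by linarith
  have hle {n : ℕ} (f : Fin n → K) (j : Fin n) : infNorm w (f j) ≤ ⨆ j, infNorm w (f j) :=
    le_ciSup (f := fun j => infNorm w (f j)) (Set.finite_range _).bddAbove j
  have hB0 : 0 ≤ B' := (infNorm_nonneg w _).trans (hle (fun i => (b i : K)) 0)
  have hroot (x : K) : w x = infNorm w x ^ θ⁻¹ := by
    rw [infNorm, ← hθ, Real.rpow_rpow_inv (apply_nonneg w x) hθ0.ne']
  have hnat (n : ℕ) : w.1 (n : K) = n := by
    change w (n : K) = n
    rw [← InfinitePlace.norm_embedding_eq]; simp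
  have hmain := abv_factorialFunctional_le (v := w.1) (A := A' ^ θ⁻¹) hnat
    (Real.one_le_rpow hA1 (by positivity)) (a := fun j => (α j : K))
    (fun j => by
      change w (α j : K) ≤ _
      rw [hroot]
      exact Real.rpow_le_rpow (infNorm_nonneg w _)
        ((hle (fun j => (α j : K)) j).trans (le_max_right _ _)) (by positivity))
    (b := fun i => (b i : K)) (B := B' ^ θ⁻¹)
    (fun i => by
      change w (b i : K) ≤ _
      rw [hroot]
      exact Real.rpow_le_rpow (infNorm_nonneg w _) (hle (fun i => (b i : K)) i) (by positivity))
    l μ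
  have hAθ : (A' ^ θ⁻¹) ^ θ = A' := Real.rpow_inv_rpow hA0 hθ0.ne'
  have hBθ : (B' ^ θ⁻¹) ^ θ = B' := Real.rpow_inv_rpow hB0 hθ0.ne'
  have hsum0 (j : Fin m) : 0 ≤ w.1 (α j : K) + A' ^ θ⁻¹ :=
    add_nonneg (w.1.nonneg _) (by positivity)
  have hsum (j : Fin m) : (w.1 (α j : K) + A' ^ θ⁻¹) ^ θ ≤ infNorm w (α j : K) + A' := by
    refine (Real.rpow_add_le_add_rpow (w.1.nonneg _) (by positivity) hθ0.le hθ1).trans_eq ?_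
    rw [hAθ]
    rfl
  have hprod : ((∏ j, (w.1 (α j : K) + A' ^ θ⁻¹)) ^ l * (A' ^ θ⁻¹) ^ μ) ^ θ ≤
      (A' ^ m * ∏ i, (infNorm w (α i : K) + A')) ^ l := by
    have h1 : 0 ≤ ∏ j, (w.1 (α j : K) + A' ^ θ⁻¹) := Finset.prod_nonneg fun j _ => hsum0 j
    rw [Real.mul_rpow (pow_nonneg h1 _) (by positivity), ← Real.rpow_pow_comm h1,
      ← Real.rpow_pow_comm (by positivity), hAθ, ← Real.finsetProd_rpow _ _ fun j _ => hsum0 j,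
      mul_comm, mul_pow]
    -- The factor coming from `X ^ μ` is absorbed by the `m`-th power of the maximum in `c₁`, since
    -- `μ ≤ m` and `l ≥ 1`.
    have h2 : A' ^ μ ≤ (A' ^ m) ^ l :=
      (pow_le_pow_right₀ hA1 hμ).trans (le_self_pow₀ (one_le_pow₀ hA1) (by omega))
    have h3 : ∏ j, (w.1 (α j : K) + A' ^ θ⁻¹) ^ θ ≤ ∏ i, (infNorm w (α i : K) + A') :=
      Finset.prod_le_prod (fun j _ => Real.rpow_nonneg (hsum0 j) _) fun j _ => hsum j
    have h4 : 0 ≤ ∏ j, (w.1 (α j : K) + A' ^ θ⁻¹) ^ θ :=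
      Finset.prod_nonneg fun j _ => Real.rpow_nonneg (hsum0 j) _
    gcongr
  have hprod0 : 0 ≤ (∏ j, (w.1 (α j : K) + A' ^ θ⁻¹)) ^ l * (A' ^ θ⁻¹) ^ μ :=
    mul_nonneg (pow_nonneg (Finset.prod_nonneg fun j _ => hsum0 j) _) (by positivity)
  have hW : w (approxForm α b l μ) ≤ (((m * l + μ).factorial * (m + 1) : ℕ) : ℝ) * B' ^ θ⁻¹ *
      ((∏ j, (w.1 (α j : K) + A' ^ θ⁻¹)) ^ l * (A' ^ θ⁻¹) ^ μ) := by
    rw [approxForm, map_mul]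
    have h1 : w ((m * l + μ).factorial : K) = (m * l + μ).factorial := hnat _
    rw [h1]
    refine (mul_le_mul_of_nonneg_left hmain (Nat.cast_nonneg _)).trans_eq ?_
    push_cast
    ring
  calc infNorm w (approxForm α b l μ) = w (approxForm α b l μ) ^ θ := rfl
    _ ≤ _ := Real.rpow_le_rpow (apply_nonneg w _) hW hθ0.le
    _ = _ := by
      rw [Real.mul_rpow (by positivity) hprod0, Real.mul_rpow (by positivity) (by positivity), hBθ]
    _ ≤ _ := by
      rw [infNorm_natCast, ← hθ]
      gcongr

theorem prod_infNorm_approxForm_le {m : ℕ} (α : Fin m → 𝓞 K) (b : Fin (m + 1) → 𝓞 K) {l μ : ℕ}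
    (hl : 1 ≤ l) (hμ : μ ≤ m) :
    ∏ w : InfinitePlace K, infNorm w (approxForm α b l μ) ≤
      ((m * l + μ).factorial : ℝ) * (m + 1) * archHeight b * c₁ α ^ l := by
  refine (Finset.prod_le_prod (fun w _ => infNorm_nonneg w _)
    fun w _ => infNorm_approxForm_le α b hl hμ w).trans_eq ?_
  rw [Finset.prod_mul_distrib, Finset.prod_mul_distrib, Finset.prod_pow, prod_infNorm_natCast,
    archHeight, c₁]
  push_cast
  ring

end InfinitePlaces

/-! ### Divisibility of the forms and the product formula. -/

section FinitePlaces

theorem isUltrametricDist_adicCompletion (v : HeightOneSpectrum (𝓞 K)) :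
    IsUltrametricDist (v.adicCompletion K) := by
  let _ := HeightOneSpectrum.instRankOneAdicCompletion K v
  exact Valued.instIsUltrametricDist _ _

theorem charZero_adicCompletion (v : HeightOneSpectrum (𝓞 K)) : CharZero (v.adicCompletion K) :=
  charZero_of_injective_ringHom (FinitePlace.embedding v).injective

theorem natDegree_prod_pow_mul_le {R : Type*} [CommRing R] [Nontrivial R] {m : ℕ} (a : Fin m → R)
    (l μ : ℕ) :
    ((∏ j, (Polynomial.X - Polynomial.C (a j))) ^ l * Polynomial.X ^ μ).natDegree ≤ m * l + μ := by
  have h : (∏ j, (Polynomial.X - Polynomial.C (a j))).natDegree = m := by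
    rw [Polynomial.natDegree_finsetProd_X_sub_C_eq_card]; simp
  refine Polynomial.natDegree_mul_le.trans (add_le_add ?_ (Polynomial.natDegree_X_pow_le μ))
  refine Polynomial.natDegree_pow_le.trans_eq ?_
  rw [h, mul_comm]

theorem norm_embedding_approxForm {m : ℕ} (α : Fin m → 𝓞 K) (b : Fin (m + 1) → 𝓞 K) (l μ : ℕ)
    (v : HeightOneSpectrum (𝓞 K)) :
    ‖FinitePlace.embedding v (approxForm α b l μ)‖ ≤ 1 ∧
    ‖FinitePlace.embedding v (approxForm α b l μ)‖ ≤ max ‖linForm v α b‖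
      ‖(((m * l + μ).factorial * l.factorial : ℕ) : v.adicCompletion K)‖ := by
  have := isUltrametricDist_adicCompletion v
  have := charZero_adicCompletion v
  set ψ := FinitePlace.embedding (K := K) v with hψ
  have hint (x : 𝓞 K) : ‖ψ (x : K)‖ ≤ 1 := FinitePlace.norm_le_one K v x
  set f := (∏ j, (Polynomial.X - Polynomial.C (ψ (α j : K)))) ^ l * Polynomial.X ^ μ with hf
  have hform : ψ (approxForm α b l μ) = ((m * l + μ).factorial : v.adicCompletion K) *
      factorialFunctional (fun k => ψ (b 0 : K) + ∑ j : Fin m, ψ (b j.succ : K) *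
        ∑ h ∈ Finset.range k, (h.factorial : v.adicCompletion K) * ψ (α j : K) ^ h) f := by
    rw [approxForm, map_mul, map_factorialFunctional, map_natCast]
    simp [hf, Polynomial.map_prod]
  have hcoeff (k : ℕ) : ‖f.coeff k‖ ≤ 1 := by
    have h1 : f = ((∏ j, (Polynomial.X - Polynomial.C (α j))) ^ l * Polynomial.X ^ μ).map
        (ψ.comp (algebraMap (𝓞 K) K)) := by
      simp [hf, Polynomial.map_prod]
    rw [h1, Polynomial.coeff_map]
    exact hint _
  have hdeg : f.natDegree ≤ m * l + μ := natDegree_prod_pow_mul_le _ l μ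
  rw [hform]
  refine ⟨norm_form_le_one (a := fun j => ψ (α j : K)) (b := fun i => ψ (b i : K)) hdeg hcoeff
    (fun j => hint _) fun i => hint _, ?_⟩
  exact norm_form_le_max (a := fun j => ψ (α j : K)) (b := fun i => ψ (b i : K))
    (F := fun j => eulerF v (α j)) hdeg hcoeff (fun j => hint _)
    (fun j => (summable_eulerSeries v (α j)).hasSum)
    (fun j => (pow_dvd_pow_of_dvd (Finset.dvd_prod_of_mem _ (Finset.mem_univ j)) l).mul_right _)
    fun i => hint _

/-- An element of `K` which is integral at all finite places has Archimedean size at least `1`. -/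
theorem one_le_prod_infinitePlace {x : K} (hx : x ≠ 0)
    (h : ∀ v : HeightOneSpectrum (𝓞 K), ‖FinitePlace.embedding v x‖ ≤ 1) :
    1 ≤ ∏ w : InfinitePlace K, w x ^ w.mult := by
  have h1 := prod_abs_eq_one hx
  have h2 : 0 ≤ ∏ᶠ w : FinitePlace K, w x ∧ ∏ᶠ w : FinitePlace K, w x ≤ 1 := by
    refine finprod_induction (fun y : ℝ => 0 ≤ y ∧ y ≤ 1) ⟨zero_le_one, le_rfl⟩ ?_ ?_
    · exact fun y z hy hz => ⟨mul_nonneg hy.1 hz.1, mul_le_one₀ hy.2 hz.1 hz.2⟩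
    · intro w
      refine ⟨apply_nonneg w x, ?_⟩
      rw [← FinitePlace.norm_embedding_eq]
      exact h _
  have h3 : 0 ≤ ∏ w : InfinitePlace K, w x ^ w.mult :=
    Finset.prod_nonneg fun w _ => pow_nonneg (apply_nonneg w x) _
  rw [← h1]
  exact mul_le_of_le_one_right h3 h2.2

/-- The quotient `x / n` is integral at every finite place, so the product formula applies to it. -/
theorem natCast_le_prod_infNorm {x : K} (hx : x ≠ 0) {n : ℕ} (hn : n ≠ 0)
    (h : ∀ v : HeightOneSpectrum (𝓞 K),
      ‖FinitePlace.embedding v x‖ ≤ ‖(n : v.adicCompletion K)‖) :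
    (n : ℝ) ≤ ∏ w : InfinitePlace K, infNorm w x := by
  have hn' : (n : K) ≠ 0 := Nat.cast_ne_zero.2 hn
  have h1 := one_le_prod_infinitePlace (div_ne_zero hx hn') fun v => by
    have := charZero_adicCompletion v
    have h0 : 0 < ‖(n : v.adicCompletion K)‖ := norm_pos_iff.2 (Nat.cast_ne_zero.2 hn)
    rw [map_div₀, norm_div, map_natCast, div_le_one h0]
    exact h v
  simp_rw [map_div₀, div_pow, Finset.prod_div_distrib, prod_natCast_pow_mult] at h1
  rw [le_div_iff₀ (by positivity), one_mul] at h1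
  rw [prod_infNorm]
  calc (n : ℝ) = ((n : ℝ) ^ Module.finrank ℚ K) ^ (1 / (Module.finrank ℚ K : ℝ)) := by
        rw [← Real.rpow_natCast, ← Real.rpow_mul (Nat.cast_nonneg n),
          mul_one_div_cancel finrank_pos_real.ne', Real.rpow_one]
    _ ≤ _ := by gcongr

/-- The power of `v` dividing `(n)` has ideal norm dividing that of `(n)`, which is `n ^ κ`. -/
theorem one_div_natCast_le_finNorm (v : HeightOneSpectrum (𝓞 K)) {n : ℕ} (hn : n ≠ 0) :
    1 / (n : ℝ) ≤ finNorm v (n : v.adicCompletion K) := by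
  have hn0 : (n : 𝓞 K) ≠ 0 := Nat.cast_ne_zero.2 hn
  have h1 := NumberField.FinitePlace.apply_mul_absNorm_pow_eq_one (FinitePlace.mk v) hn0
  rw [FinitePlace.maximalIdeal_mk, FinitePlace.mk_apply] at h1
  have h2 : Ideal.absNorm v.asIdeal ^ multiplicity v.asIdeal (Ideal.span {(n : 𝓞 K)}) ≤
      n ^ Module.finrank ℚ K := by
    have h3 := map_dvd Ideal.absNorm (pow_multiplicity_dvd v.asIdeal (Ideal.span {(n : 𝓞 K)}))
    have h4 : Ideal.absNorm (Ideal.span {(n : 𝓞 K)}) = n ^ Module.finrank ℚ K := by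
      rw [Ideal.absNorm_span_singleton, ← RingOfIntegers.rank,
        show (n : 𝓞 K) = algebraMap ℤ (𝓞 K) n by simp, Algebra.norm_algebraMap, Int.natAbs_pow,
        Int.natAbs_natCast]
    rw [map_pow, h4] at h3
    exact Nat.le_of_dvd (by positivity) h3
  have hnorm : ((n : ℝ) ^ Module.finrank ℚ K)⁻¹ ≤ ‖(n : v.adicCompletion K)‖ := by
    have h5 : FinitePlace.embedding v ((n : 𝓞 K) : K) = (n : v.adicCompletion K) := by simp
    rw [h5] at h1
    rw [inv_le_iff_one_le_mul₀ (by positivity), ← h1]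
    gcongr
    exact_mod_cast h2
  rw [finNorm]
  calc 1 / (n : ℝ) = (((n : ℝ) ^ Module.finrank ℚ K)⁻¹) ^ (1 / (Module.finrank ℚ K : ℝ)) := by
        rw [Real.inv_rpow (by positivity), ← Real.rpow_natCast, ← Real.rpow_mul (Nat.cast_nonneg n),
          mul_one_div_cancel finrank_pos_real.ne', Real.rpow_one, one_div]
    _ ≤ _ := by gcongr

theorem norm_natCast_eq_one (v : HeightOneSpectrum (𝓞 K)) {n : ℕ} (h : (n : 𝓞 K) ∉ v.asIdeal) :
    ‖(n : v.adicCompletion K)‖ = 1 := by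
  have := (FinitePlace.norm_eq_one_iff_notMem K v (n : 𝓞 K)).2 h
  simpa using this

theorem natCast_notMem_of_coprime (v : HeightOneSpectrum (𝓞 K)) {p n : ℕ}
    (hv : (p : 𝓞 K) ∈ v.asIdeal) (h : p.Coprime n) : (n : 𝓞 K) ∉ v.asIdeal := by
  intro hn
  obtain ⟨a, b, hab⟩ := Nat.isCoprime_iff_coprime.2 h
  refine v.isPrime.ne_top ((Ideal.eq_top_iff_one _).2 ?_)
  have h1 : (a : 𝓞 K) * p + b * n = 1 := by exact_mod_cast congrArg (Int.cast : ℤ → 𝓞 K) hab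
  rw [← h1]
  exact add_mem (Ideal.mul_mem_left _ _ hv) (Ideal.mul_mem_left _ _ hn)

theorem exists_prime_dvd_of_mem {R : Type*} [CommRing R] {I : Ideal R} (hI : I.IsPrime) {n : ℕ} (hn : n ≠ 0)
    (h : (n : R) ∈ I) : ∃ p : ℕ, p.Prime ∧ p ∣ n ∧ (p : R) ∈ I := by
  by_contra! hcon
  have key : ∀ n : ℕ, (∀ p : ℕ, p.Prime → p ∣ n → (p : R) ∉ I) → n ≠ 0 →
      (n : R) ∉ I := by
    intro n
    induction n using Nat.recOnMul with
    | zero => exact fun _ h => absurd rfl h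
    | one => 
      exact fun _ _ h1 => hI.ne_top ((Ideal.eq_top_iff_one _).2 (by simpa using h1))
    | prime p hp => exact fun h _ => h p hp dvd_rfl
    | mul a b iha ihb =>
      intro h h0 hab
      rw [Nat.cast_mul] at hab
      rcases hI.mem_or_mem hab with hmem | hmem
      · exact iha (fun p hp hpa => h p hp (hpa.mul_right b)) (left_ne_zero_of_mul h0) hmem
      · exact ihb (fun p hp hpb => h p hp (hpb.mul_left a)) (right_ne_zero_of_mul h0) hmem
  exact key n hcon hn h

/-- Only the `p`-part of `M! l!` matters at `v`, and it is at most `2 ^ (M + l)`. This bound is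
uniform in `p`, so one threshold on the linear form serves all primes. -/
theorem two_pow_inv_le_finNorm (v : HeightOneSpectrum (𝓞 K)) {p : ℕ} (hp : p.Prime)
    (hv : (p : 𝓞 K) ∈ v.asIdeal) (M l : ℕ) :
    1 / (2 : ℝ) ^ (M + l) ≤
      finNorm v ((M.factorial * l.factorial : ℕ) : v.adicCompletion K) := by
  set N := M.factorial * l.factorial with hN
  have hN0 : N ≠ 0 := mul_ne_zero M.factorial_ne_zero l.factorial_ne_zero
  have h1 : finNorm v (N : v.adicCompletion K) =
      finNorm v ((p ^ N.factorization p : ℕ) : v.adicCompletion K) := by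
    have h2 := Nat.ordProj_mul_ordCompl_eq_self N p
    have h3 := norm_natCast_eq_one v
      (natCast_notMem_of_coprime v hv (Nat.coprime_ordCompl hp hN0))
    rw [finNorm, finNorm]
    conv_lhs => rw [← h2, Nat.cast_mul, norm_mul, h3, mul_one]
  rw [h1]
  refine le_trans ?_ (one_div_natCast_le_finNorm v (pow_ne_zero _ hp.ne_zero))
  have h4 : p ^ N.factorization p ≤ 2 ^ (M + l) := by
    rw [hN, Nat.factorization_mul M.factorial_ne_zero l.factorial_ne_zero, Finsupp.add_apply,
      pow_add, pow_add]
    exact Nat.mul_le_mul (pow_factorization_factorial_le_two_pow hp M)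
      (pow_factorization_factorial_le_two_pow hp l)
  have h5 : (0 : ℝ) < (p ^ N.factorization p : ℕ) := by exact_mod_cast pow_pos hp.pos _
  refine one_div_le_one_div_of_le h5 ?_
  exact_mod_cast h4

theorem norm_le_norm_of_finNorm_le {v : HeightOneSpectrum (𝓞 K)} {x y : v.adicCompletion K}
    (h : finNorm v x ≤ finNorm v y) : ‖x‖ ≤ ‖y‖ :=
  (Real.rpow_le_rpow_iff (norm_nonneg _) (norm_nonneg _)
    (one_div_pos.2 (finrank_pos_real (K := K)))).1 h

/-- If all values of the linear form at the primes above `u` are small, the approximation form is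
divisible by the large part of the factorials. -/
theorem largePart_le_prod_infNorm_approxForm {m : ℕ} (α : Fin m → 𝓞 K) (b : Fin (m + 1) → 𝓞 K)
    {l μ u : ℕ} (hW : approxForm α b l μ ≠ 0)
    (h : ∀ p : ℕ, p.Prime → u < p → p ∣ (m * l + μ).factorial * l.factorial →
      ∀ v : HeightOneSpectrum (𝓞 K), (p : 𝓞 K) ∈ v.asIdeal →
        finNorm v (linForm v α b) ≤ 1 / (2 : ℝ) ^ (m * l + μ + l)) :
    (largePart u ((m * l + μ).factorial * l.factorial) : ℝ) ≤
      ∏ w : InfinitePlace K, infNorm w (approxForm α b l μ) := by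
  set N := (m * l + μ).factorial * l.factorial with hN
  have hN0 : N ≠ 0 := mul_ne_zero (Nat.factorial_ne_zero _) l.factorial_ne_zero
  have hmul := smallPart_mul_largePart u hN0
  have hL0 : largePart u N ≠ 0 := fun h0 => hN0 (by rw [← hmul, h0, mul_zero])
  refine natCast_le_prod_infNorm hW hL0 fun v => ?_
  have := isUltrametricDist_adicCompletion v
  obtain ⟨hW1, hW2⟩ := norm_embedding_approxForm α b l μ v
  -- Either `v` lies above a prime exceeding `u`, where the linear form is small, or the large part
  -- is a unit at `v` and integrality of the form suffices.
  by_cases hv : (largePart u N : 𝓞 K) ∈ v.asIdeal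
  · obtain ⟨p, hp, hpL, hpv⟩ := exists_prime_dvd_of_mem v.isPrime hL0 hv
    obtain ⟨hup, hpN⟩ := prime_dvd_largePart hp hpL
    refine (hW2.trans (max_le ?_ le_rfl)).trans ?_
    · exact norm_le_norm_of_finNorm_le
        ((h p hp hup hpN v hpv).trans (two_pow_inv_le_finNorm v hp hpv _ _))
    · have hnorm : ‖(N : v.adicCompletion K)‖ = ‖(smallPart u N : v.adicCompletion K)‖ *
          ‖(largePart u N : v.adicCompletion K)‖ := by
        rw [← norm_mul, ← Nat.cast_mul, hmul]
      rw [hnorm]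
      exact mul_le_of_le_one_left (norm_nonneg _)
        (IsUltrametricDist.norm_natCast_le_one (v.adicCompletion K) _)
  · rwa [norm_natCast_eq_one v hv]

end FinitePlaces


/-! ### Choice of parameters. -/

section Numerics

theorem le_log_factorial {z : ℝ} (hz : 1 ≤ z) {n : ℕ} (hn : z ≤ n) :
    z * Real.log z - z ≤ Real.log n.factorial := by
  have hz0 : 0 < z := by linarith
  have hn0 : (0 : ℝ) < n := by linarith
  have h1 := Stirling.le_log_factorial_stirling (n := n) (by rintro rfl; simp at hn0)
  have h2 : 0 ≤ Real.log n := Real.log_nonneg (by linarith)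
  have h3 : 0 ≤ Real.log (2 * Real.pi) := Real.log_nonneg (by linarith [Real.pi_gt_three])
  have h4 := Real.log_le_sub_one_of_pos (div_pos hz0 hn0)
  rw [Real.log_div hz0.ne' hn0.ne'] at h4
  have h5 : n * (Real.log z - Real.log n) ≤ z - n := by
    calc n * (Real.log z - Real.log n) ≤ n * (z / n - 1) := by gcongr
      _ = z - n := by field_simp
  have h6 : z * Real.log z ≤ n * Real.log z := by
    gcongr
    exact Real.log_nonneg hz
  linarith

/-- The Stirling bound is used for `(l + 1)!`, as `l + 1` exceeds `16 Z`. Passing back to `l!` costs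
`log (l + 1) ≤ log (Y Z) = Y`, and `log 16 ≥ 1` absorbs the linear term. -/
theorem le_log_factorial_floor {Y Z : ℝ} (hY : 17 ≤ Y) (hYZ : Y ≤ Z)
    (hlogZ : Real.log Z = Y - Real.log Y) {l : ℕ} (hl1 : (l : ℝ) ≤ 16 * Z) (hl2 : 16 * Z < l + 1) :
    16 * Z * (Y - Real.log Y) - Y ≤ Real.log l.factorial := by
  have hY0 : 0 < Y := by linarith
  have hZ0 : 0 < Z := by linarith
  have h1 := le_log_factorial (z := 16 * Z) (by linarith) (n := l + 1) (by push_cast; exact hl2.le)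
  rw [Nat.factorial_succ, Nat.cast_mul, Real.log_mul (by norm_num) hZ0.ne', hlogZ,
    Real.log_mul (by positivity) (by positivity)] at h1
  have h2 : Real.log ((l + 1 : ℕ) : ℝ) ≤ Y := by
    calc Real.log ((l + 1 : ℕ) : ℝ) ≤ Real.log (Y * Z) := by
          refine Real.log_le_log (by positivity) ?_
          push_cast
          nlinarith
      _ = Y := by rw [Real.log_mul hY0.ne' hZ0.ne', hlogZ]; ring
  have h3 : 1 ≤ Real.log 16 := by
    rw [Real.le_log_iff_exp_le (by norm_num)]
    linarith [Real.exp_one_lt_d9]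
  nlinarith

/-- The choice of the order of the approximation forms. -/
theorem exists_order {m : ℕ} (hm : 1 ≤ m) {X s c : ℝ} (hc : 1 ≤ c) (hcs : c + 1 ≤ s)
    (hms : ((m : ℝ) + 3) ^ 2 + 1 ≤ s) (hX : s * Real.exp s ≤ X) :
    1 ≤ Real.log (X / Real.log X) ∧ 1 ≤ Real.log X ∧ 1 ≤ Real.log (Real.log X) ∧ 0 < X ∧
    ∃ l : ℕ, 1 ≤ l ∧ (l : ℝ) + 1 < 17 * (X / Real.log X) ∧ (l : ℝ) + 1 ≤ X ∧
      ∀ u : ℕ, u ≤ Real.log (X / Real.log X) →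
        Real.log (m + 1) + X + l * Real.log c + ((m : ℝ) + 1) * (l + 1) * (0.92 * √u) <
          Real.log l.factorial := by
  have hm' : (1 : ℝ) ≤ m := by exact_mod_cast hm
  have hs17 : 17 ≤ s := by nlinarith
  have hX0 : 0 < X := lt_of_lt_of_le (by positivity) hX
  set Y := Real.log X with hY
  have hYs : s ≤ Y := by
    rw [hY, Real.le_log_iff_exp_le hX0]
    refine le_trans ?_ hX
    nlinarith [Real.exp_pos s]
  set Z := X / Y with hZ
  have hY0 : 0 < Y := by linarith
  have hZ0 : 0 < Z := div_pos hX0 hY0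
  have hZY : Z * Y = X := div_mul_cancel₀ _ hY0.ne'
  set g := Real.log Y with hg
  have hlogZ : Real.log Z = Y - g := by rw [hZ, Real.log_div hX0.ne' hY0.ne']
  set r := √Y with hr
  have hr2 : r ^ 2 = Y := Real.sq_sqrt hY0.le
  have hr0 : 0 ≤ r := Real.sqrt_nonneg _
  have hr4 : 4.1 ≤ r := Real.le_sqrt_of_sq_le (by norm_num; linarith)
  have hgr : g ≤ 0.7358 * r := log_le_mul_sqrt hY0
  have hg1 : 1 ≤ g := by
    rw [hg, Real.le_log_iff_exp_le hY0]
    linarith [Real.exp_one_lt_d9]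
  have hmr : (m : ℝ) + 1 ≤ r - 2 := by
    have : (m : ℝ) + 3 ≤ r := Real.le_sqrt_of_sq_le (by linarith)
    linarith
  have hYZ : Y ≤ Z := by
    have h1 : g ≤ Real.log Z := by rw [hlogZ]; nlinarith
    exact (Real.log_le_log_iff hY0 hZ0).1 h1
  have hlogc : Real.log c ≤ g := Real.log_le_log (by linarith) (by linarith)
  have hlogm : Real.log (m + 1) ≤ g := Real.log_le_log (by linarith) (by nlinarith)
  refine ⟨by rw [hlogZ]; nlinarith, by linarith, hg1, hX0, ⌊16 * Z⌋₊, ?_, ?_, ?_, fun u hu => ?_⟩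
  · exact Nat.le_floor (by push_cast; linarith)
  · linarith [Nat.floor_le (show 0 ≤ 16 * Z by positivity)]
  · nlinarith [Nat.floor_le (show 0 ≤ 16 * Z by positivity)]
  set l := ⌊16 * Z⌋₊
  have hl1 : (l : ℝ) ≤ 16 * Z := Nat.floor_le (by positivity)
  have hl2 : 16 * Z < l + 1 := Nat.lt_floor_add_one _
  have hl0 : (0 : ℝ) ≤ l := Nat.cast_nonneg _
  have hfac : 16 * Z * (Y - g) - Y ≤ Real.log l.factorial :=
    le_log_factorial_floor (by linarith) hYZ hlogZ hl1 hl2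
  have hu' : √(u : ℝ) ≤ r := Real.sqrt_le_sqrt (by linarith)
  have h1 : l * Real.log c ≤ 16 * Z * g := by
    have := Real.log_nonneg hc
    gcongr
  have h2 : ((m : ℝ) + 1) * (l + 1) * (0.92 * √u) ≤ (r - 2) * (16 * Z + 1) * (0.92 * r) := by
    have : 0 ≤ r - 2 := by linarith
    gcongr
  have h3 : (r - 2) * (16 * Z + 1) * (0.92 * r) = (16 * Z + 1) * (0.92 * Y - 1.84 * r) := by
    rw [← hr2]; ring
  -- In units of `Z`, with `X = Z Y`: the `16 Y` from `log l!` pays for `Y` from `H`, `32 g` from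
  -- Stirling and `c`, and `16 * 0.92 (r - 2) r` from small primes. The saving `29.44 r`, due to `m
  -- + 1 ≤ r - 2`, outweighs `32 g`.
  have h4 : 28 ≤ 15 * Y - 32 * g - 14.72 * Y + 29.44 * r := by linarith
  have h5 : Y * 28 ≤ Z * (15 * Y - 32 * g - 14.72 * Y + 29.44 * r) := by gcongr
  have h6 : g ≤ Y := Real.log_le_self hY0.le
  rw [h3] at h2
  linarith

end Numerics

end EulerSeries

/-! ### Conclusion by contradiction. -/

theorem mainTheorem2 {K : Type*} [Field K] [NumberField K]
    (m : ℕ) (hm : 1 ≤ m)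
    (α : Fin m → 𝓞 K) (hα_inj : Function.Injective α) (hα_ne : ∀ j, α j ≠ 0)
    (H s : ℝ)
    (hs : s = max (Real.exp (Module.finrank ℚ K : ℝ) + 1)
      (max (EulerSeries.c₁ α + 1) (((m : ℝ) + 3) ^ 2 + 1)))
    (hH : s * Real.exp s ≤ Real.log H)
    (l : Fin (m + 1) → 𝓞 K) (hl : ∃ i, l i ≠ 0)
    (hheight : EulerSeries.archHeight l ≤ H) :
    ∃ p : ℕ, p.Prime ∧
      Real.log (Real.log H / Real.log (Real.log H)) < (p : ℝ) ∧
      (p : ℝ) < 17 * (m : ℝ) * Real.log H / Real.log (Real.log H) ∧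
      ∃ v : HeightOneSpectrum (𝓞 K), (p : 𝓞 K) ∈ v.asIdeal ∧
        EulerSeries.finNorm v (EulerSeries.linForm v α l) >
          H ^ (-((m : ℝ) + 1) - 114 * (m : ℝ) ^ 2 *
            (Real.log (Real.log (Real.log H)) / Real.log (Real.log H))) := by
  open EulerSeries in
  by_contra! hcon
  have hc := one_le_c₁ α
  have hcs : c₁ α + 1 ≤ s := hs ▸ (le_max_left _ _).trans (le_max_right _ _)
  have hms : ((m : ℝ) + 3) ^ 2 + 1 ≤ s := hs ▸ (le_max_right _ _).trans (le_max_right _ _)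
  obtain ⟨hZ, hY, hloglog, hX0, d, hd1, hdZ, hdX, hd⟩ := exists_order hm hc hcs hms hH
  have hH0 : 0 < H := by
    have h0 : 0 ≤ archHeight l := Finset.prod_nonneg fun w _ =>
      Real.iSup_nonneg fun i => infNorm_nonneg w (l i : K)
    -- `H = 0` is excluded because `Real.log 0 = 0`, while `log H > 0`.
    refine lt_of_le_of_ne (h0.trans hheight) fun h => ?_
    rw [← h, Real.log_zero] at hX0
    exact lt_irrefl _ hX0
  have hm' : (1 : ℝ) ≤ m := by exact_mod_cast hm
  set X := Real.log H with hX
  set u := ⌊Real.log (X / Real.log X)⌋₊ with hu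
  have hu1 : 1 ≤ u := Nat.le_floor (by simpa using hZ)
  have huZ : (u : ℝ) ≤ Real.log (X / Real.log X) := Nat.floor_le (by linarith)
  obtain ⟨μ, hμ, hne⟩ := exists_factorialFunctional_ne_zero (a := fun j => (α j : K))
    (fun i j h => hα_inj (RingOfIntegers.coe_injective h))
    (fun j => RingOfIntegers.coe_ne_zero_iff.2 (hα_ne j)) (fun i => (l i : K))
    (hl.imp fun i hi => RingOfIntegers.coe_ne_zero_iff.2 hi) d
  have hW : approxForm α l d μ ≠ 0 := mul_ne_zero (Nat.cast_ne_zero.2 (Nat.factorial_ne_zero _)) hne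
  have hM : m * d + μ ≤ m * (d + 1) := by rw [mul_add, mul_one]; omega
  have hMd : ((m * d + μ : ℕ) : ℝ) + d ≤ ((m : ℝ) + 1) * (d + 1) := by
    have : ((m * d + μ : ℕ) : ℝ) ≤ m * (d + 1) := by exact_mod_cast hM
    linarith
  have hsmall : H ^ (-((m : ℝ) + 1) - 114 * (m : ℝ) ^ 2 *
      (Real.log (Real.log X) / Real.log X)) ≤ 1 / (2 : ℝ) ^ (m * d + μ + d) := by
    have hH1 : 1 ≤ H := by
      by_contra! h
      exact absurd (Real.log_neg hH0 h) (by linarith)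
    have hquot : 0 ≤ 114 * (m : ℝ) ^ 2 * (Real.log (Real.log X) / Real.log X) := by
      have : 0 ≤ Real.log (Real.log X) / Real.log X := div_nonneg (by linarith) (by linarith)
      positivity
    -- The second term of the exponent only decreases the bound; `H ^ (-(m + 1))` is already small
    -- enough, since `M + d ≤ (m + 1) (d + 1) ≤ (m + 1) log H`.
    have hexp : -((m : ℝ) + 1) - 114 * (m : ℝ) ^ 2 * (Real.log (Real.log X) / Real.log X) ≤
        -((m : ℝ) + 1) := by linarith
    refine (Real.rpow_le_rpow_of_exponent_le hH1 hexp).trans ?_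
    rw [Real.rpow_neg hH0.le, one_div]
    refine inv_anti₀ (by positivity) ?_
    rw [← Real.log_le_log_iff (by positivity) (by positivity), Real.log_pow, Real.log_rpow hH0]
    have hlog2 : Real.log 2 ≤ 1 := by linarith [Real.log_two_lt_d9]
    calc ((m * d + μ + d : ℕ) : ℝ) * Real.log 2 ≤ ((m * d + μ + d : ℕ) : ℝ) * 1 := by gcongr
      _ ≤ ((m : ℝ) + 1) * (d + 1) := by
        rw [mul_one, Nat.cast_add]
        exact hMd
      _ ≤ ((m : ℝ) + 1) * X := by gcongr
  have hlarge := largePart_le_prod_infNorm_approxForm α l (u := u) hW fun p hp hup hpN v hpv => by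
    refine (hcon p hp ?_ ?_ v hpv).trans hsmall
    · exact Nat.lt_of_floor_lt hup
    -- A prime dividing `M! d!` is at most `m (d + 1)`, which gives the upper end of the interval.
    · have hp1 : p ≤ m * (d + 1) := by
        rcases hp.dvd_mul.1 hpN with h | h
        · exact (hp.dvd_factorial.1 h).trans hM
        · exact (hp.dvd_factorial.1 h).trans (by nlinarith)
      calc (p : ℝ) ≤ m * (d + 1) := by exact_mod_cast hp1
        _ < m * (17 * (X / Real.log X)) := by gcongr
        _ = 17 * (m : ℝ) * X / Real.log X := by ring
  have hlow := smallPart_mul_largePart u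
    (mul_ne_zero (Nat.factorial_ne_zero (m * d + μ)) d.factorial_ne_zero)
  have hup := prod_infNorm_approxForm_le α l hd1 hμ
  have hsp := smallPart_factorial_mul_factorial_le (m * d + μ) d hu1
  set M := m * d + μ
  have hM0 : (0 : ℝ) < M.factorial := by exact_mod_cast M.factorial_pos
  have hfin : (d.factorial : ℝ) ≤
      Real.exp (((M : ℝ) + d) * (0.92 * √u)) * ((m + 1) * H * c₁ α ^ d) := by
    -- The factor `M!` occurs both in the divisor `M! d!` and in the Archimedean bound; after
    -- cancellation `d!` must be small.
    refine le_of_mul_le_mul_left ?_ hM0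
    calc (M.factorial : ℝ) * d.factorial =
          smallPart u (M.factorial * d.factorial) * largePart u (M.factorial * d.factorial) := by
          exact_mod_cast hlow.symm
      _ ≤ Real.exp (((M : ℝ) + d) * (0.92 * √u)) *
          (M.factorial * (m + 1) * H * c₁ α ^ d) := by
          refine mul_le_mul hsp ((hlarge.trans hup).trans ?_) (Nat.cast_nonneg _)
            (Real.exp_pos _).le
          gcongr
      _ = _ := by ring
  have hlogfin := Real.log_le_log (by exact_mod_cast d.factorial_pos) hfin
  rw [Real.log_mul (by positivity) (by positivity), Real.log_exp,
    Real.log_mul (by positivity) (by positivity), Real.log_mul (by positivity) hH0.ne',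
    Real.log_pow] at hlogfin
  have hexp : ((M : ℝ) + d) * (0.92 * √u) ≤ ((m : ℝ) + 1) * (d + 1) * (0.92 * √u) := by gcongr
  linarith [hd u huZ]
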